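/- Let $G\subset\mathbb{R}^2$ be a nonempty bounded open set, and let $u:\overline{G}\to\mathbb{R}$ be a smooth function (smooth up to the boundary) with $u\le 0$ on $\overline G$ and $u=0$ on $\partial G$. Let $g_0$ be the standard Euclidean metric and set $g:=e^{2u}g_0$. Let $K_g$ be the Gaussian curvature of $g$ and $K_g^-:=\min\{K_g,0\}$. For real $p>1$ set $q:=p/(p-1)$ and $$\mathcal{K}_p^-(G,g):=\Bigl\|K_g^-\Bigr\|_{L^p(G,g)}\cdot \operatorname{area}(G,g)^{1-\frac1p},$$ where the $L^p$-norm and the area are taken with respect to the Riemannian area measure of $g$. Then $\mathcal{K}_p^-(G,g)$ is finite, $u$ attains a minimum on $\overline G$, and $$\min_{\overline G} u\;\ge\;-\frac{q\,\mathcal{K}_p^-(G,g)}{4\pi}.$$ -/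

import Mathlib

open MeasureTheory
open scoped ENNReal ContDiff

noncomputable section

/-- The Euclidean plane `ℝ²`. -/
abbrev Plane : Type := EuclideanSpace ℝ (Fin 2)

/-- A (not necessarily positive definite) metric tensor in the standard coordinates of the
plane: `g x i j = g_x(∂ᵢ, ∂ⱼ)`. -/
abbrev MetricField : Type := Plane → Matrix (Fin 2) (Fin 2) ℝ

/-- The standard flat metric `g₀`. -/
def flatMetric : MetricField := fun _ => 1

/-- The conformally changed metric `e^{2u} g`. -/
def conformalChange (u : Plane → ℝ) (g : MetricField) : MetricField :=
  fun x => Real.exp (2 * u x) • g x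

/-- The partial derivative `∂ᵢ f` at `x`. -/
def partialDeriv (i : Fin 2) (f : Plane → ℝ) (x : Plane) : ℝ :=
  fderiv ℝ f x (EuclideanSpace.single i 1)

/-- The Christoffel symbols of the Levi-Civita connection,
`Γᵏᵢⱼ = ½ ∑ₗ gᵏˡ (∂ᵢ gⱼₗ + ∂ⱼ gᵢₗ - ∂ₗ gᵢⱼ)`. -/
def christoffel (g : MetricField) (k i j : Fin 2) (x : Plane) : ℝ :=
  (1 / 2 : ℝ) * ∑ l, (g x)⁻¹ k l *
    (partialDeriv i (fun y => g y j l) x + partialDeriv j (fun y => g y i l) x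
      - partialDeriv l (fun y => g y i j) x)

/-- The `l`-th component of `R(∂ᵢ, ∂ⱼ)∂ₖ`, where
`R(X, Y)Z = ∇_X ∇_Y Z - ∇_Y ∇_X Z - ∇_[X,Y] Z`. -/
def riemannTensor (g : MetricField) (l i j k : Fin 2) (x : Plane) : ℝ :=
  partialDeriv i (christoffel g l j k) x - partialDeriv j (christoffel g l i k) x
    + ∑ m, (christoffel g l i m x * christoffel g m j k x
        - christoffel g l j m x * christoffel g m i k x)

/-- The Gaussian curvature `K_g = g(R(∂₀, ∂₁)∂₁, ∂₀) / det g`. -/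
def gaussCurvature (g : MetricField) (x : Plane) : ℝ :=
  (∑ l, g x 0 l * riemannTensor g l 0 1 1 x) / (g x).det

/-- The Riemannian area measure `√(det g) dx` on the region `G`. -/
def areaMeasure (G : Set Plane) (g : MetricField) : Measure Plane :=
  (volume.restrict G).withDensity fun x => ENNReal.ofReal (Real.sqrt (g x).det)

/-- `𝒦ₚ⁻(G, g) = ‖K_g⁻‖_{Lᵖ(G,g)} · area(G, g)^{1 - 1/p}`, with `K_g⁻ = min {K_g, 0}`,
as an extended nonnegative real. -/
def curvatureMinus (p : ℝ) (G : Set Plane) (g : MetricField) : ℝ≥0∞ :=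
  eLpNorm (fun x => min (gaussCurvature g x) 0) (ENNReal.ofReal p) (areaMeasure G g)
    * areaMeasure G g Set.univ ^ (1 - 1 / p)

end

/-!
Put `v = -u`. By the Liouville equation `K_g = -e^{-2u} Δu`
(`gaussCurvature_conformalChange`), the negative curvature of a set `S` is the integral of the
positive part of `Δu = -Δv` over `S`, so by Hölder's inequality it is at most
`‖K_g⁻‖_p · area_g(S)^{1/q}` (`integral_laplace_pos_le`).

The estimate of `max v` is Talenti's level-set argument in finite-difference form, which needs
neither the coarea formula nor derivatives of the distribution function. The isoperimetric input
is the sharp Sobolev inequality `4π ∫ w² ≤ (∫ |∇w|)²` (`sobolev_square`, `sobolev_plane`), proved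
by transporting the density `w²` to the unit disk with an explicit Knothe map. Applied to a
truncation of `v` between the levels `t` and `t + h`, together with the Cauchy–Schwarz inequality
and Green's formula, it gives

  `4π h μ(t + h) ≤ (μ(t) - μ(t + h)) ∫_{v > t} (-Δv)⁺`, where `μ(t) = |{v > t}|`

(`four_pi_mul_volume_superlevel_le`). Since `e^{2u}` is at most `e^{-2(t + h)}` where `v > t + h`
and at least that elsewhere, `μ` may be replaced by the area `a(t)` of `{v > t}` in the metric `g`;
with Hölder's inequality,

  `4π h a(t + h) ≤ ‖K_g⁻‖_p (a(t) - a(t + h)) a(t)^{1/q}`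

(`four_pi_mul_area_sublevel_le`). This is a discrete form of `4π ≤ -q ‖K_g⁻‖_p (a^{1/q})'`. Its
sum over finer and finer partitions of `[0, T]` is
`4π T ≤ q ‖K_g⁻‖_p a(0)^{1/q}` for every `T < max v`
(`mul_le_of_discrete_differential_inequality`).

Finiteness of `𝒦ₚ⁻` holds because the second derivatives of `u` are bounded on `G`
(`exists_laplace_bound`).
-/

/-! ### The Gaussian curvature of a conformal metric -/

/-- The flat Laplacian `∂₀∂₀ f + ∂₁∂₁ f`. -/
noncomputable def laplace (f : Plane → ℝ) (x : Plane) : ℝ :=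
  partialDeriv 0 (partialDeriv 0 f) x + partialDeriv 1 (partialDeriv 1 f) x

theorem partialDeriv_congr {f f' : Plane → ℝ} {x : Plane} (i : Fin 2)
    (h : f =ᶠ[nhds x] f') : partialDeriv i f x = partialDeriv i f' x := by
  unfold partialDeriv
  rw [h.fderiv_eq]

theorem partialDeriv_const (i : Fin 2) (c : ℝ) (x : Plane) :
    partialDeriv i (fun _ => c) x = 0 := by
  simp [partialDeriv]

theorem partialDeriv_neg (i : Fin 2) (f : Plane → ℝ) (x : Plane) :
    partialDeriv i (fun y => -f y) x = -partialDeriv i f x := by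
  simp [partialDeriv]

theorem laplace_neg (f : Plane → ℝ) (x : Plane) :
    laplace (fun y => -f y) x = -laplace f x := by
  have h (i : Fin 2) : partialDeriv i (fun y => -f y) = fun y => -partialDeriv i f y :=
    funext (partialDeriv_neg i f)
  simp only [laplace, h, partialDeriv_neg]
  ring

theorem partialDeriv_comp {φ : ℝ → ℝ} {φ' : ℝ} {f : Plane → ℝ} {x : Plane} (i : Fin 2)
    (hφ : HasDerivAt φ φ' (f x)) (hf : DifferentiableAt ℝ f x) :
    partialDeriv i (fun y => φ (f y)) x = φ' * partialDeriv i f x := by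
  have := (hφ.comp_hasFDerivAt x hf.hasFDerivAt).fderiv
  unfold partialDeriv
  simp only [Function.comp_def] at this
  rw [this]
  simp

theorem contDiffOn_partialDeriv {f : Plane → ℝ} {U : Set Plane} (hU : IsOpen U)
    {m n : WithTop ℕ∞} (hf : ContDiffOn ℝ n f U) (hmn : m + 1 ≤ n) (i : Fin 2) :
    ContDiffOn ℝ m (partialDeriv i f) U :=
  (hf.fderiv_of_isOpen hU hmn).clm_apply contDiffOn_const

theorem continuousOn_laplace {G : Set Plane} (hGo : IsOpen G) {u : Plane → ℝ}
    (hu : ContDiffOn ℝ 2 u G) : ContinuousOn (laplace u) G := by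
  have hp : ∀ i, ContDiffOn ℝ 1 (partialDeriv i u) G := fun i =>
    contDiffOn_partialDeriv hGo hu (by norm_num) i
  exact (contDiffOn_partialDeriv (m := 0) hGo (hp 0) (by norm_num) 0).continuousOn.add
    (contDiffOn_partialDeriv (m := 0) hGo (hp 1) (by norm_num) 1).continuousOn

theorem conformalChange_flatMetric (u : Plane → ℝ) (x : Plane) (i j : Fin 2) :
    conformalChange u flatMetric x i j = if i = j then Real.exp (2 * u x) else 0 := by
  simp [conformalChange, flatMetric, Matrix.one_apply]

theorem det_conformalChange_flatMetric (u : Plane → ℝ) (x : Plane) :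
    (conformalChange u flatMetric x).det = Real.exp (2 * u x) ^ 2 := by
  simp [Matrix.det_fin_two, conformalChange_flatMetric, sq]

theorem inv_conformalChange_flatMetric (u : Plane → ℝ) (x : Plane) (i j : Fin 2) :
    (conformalChange u flatMetric x)⁻¹ i j = if i = j then (Real.exp (2 * u x))⁻¹ else 0 := by
  have : (conformalChange u flatMetric x)⁻¹
      = (Real.exp (2 * u x))⁻¹ • (1 : Matrix (Fin 2) (Fin 2) ℝ) := by
    apply Matrix.inv_eq_right_inv
    simp [conformalChange, flatMetric, (Real.exp_pos _).ne']
  simp [this, Matrix.one_apply]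

theorem partialDeriv_conformalChange {u : Plane → ℝ} {x : Plane} (hu : DifferentiableAt ℝ u x)
    (i j l : Fin 2) :
    partialDeriv i (fun y => conformalChange u flatMetric y j l) x
      = if j = l then 2 * Real.exp (2 * u x) * partialDeriv i u x else 0 := by
  simp only [conformalChange_flatMetric]
  split_ifs with h
  · have hφ : HasDerivAt (fun s => Real.exp (2 * s)) (2 * Real.exp (2 * u x)) (u x) := by
      have := ((hasDerivAt_id (u x)).const_mul 2).exp
      simpa [mul_comm] using this
    exact partialDeriv_comp i hφ hu
  · exact partialDeriv_const i 0 x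

theorem christoffel_conformalChange {u : Plane → ℝ} {x : Plane} (hu : DifferentiableAt ℝ u x)
    (k i j : Fin 2) :
    christoffel (conformalChange u flatMetric) k i j x
      = (if k = j then partialDeriv i u x else 0) + (if k = i then partialDeriv j u x else 0)
        - (if i = j then partialDeriv k u x else 0) := by
  have he := (Real.exp_pos (2 * u x)).ne'
  simp only [christoffel, partialDeriv_conformalChange hu, inv_conformalChange_flatMetric]
  fin_cases k <;> fin_cases i <;> fin_cases j <;> simp <;> field_simp

/-- The Liouville equation `K_g = -e^{-2u} Δu` for the metric `g = e^{2u} g₀`. -/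
theorem gaussCurvature_conformalChange {u : Plane → ℝ} {U : Set Plane} (hU : IsOpen U)
    (hu : ContDiffOn ℝ 2 u U) {x : Plane} (hx : x ∈ U) :
    gaussCurvature (conformalChange u flatMetric) x
      = -(Real.exp (2 * u x))⁻¹ * laplace u x := by
  have hd : ∀ y ∈ U, DifferentiableAt ℝ u y := fun y hy =>
    (hu.differentiableOn (by norm_num)).differentiableAt (hU.mem_nhds hy)
  have hc (a k i j : Fin 2) := partialDeriv_congr (x := x) a
    (Filter.eventually_of_mem (hU.mem_nhds hx) fun y hy =>
      christoffel_conformalChange (hd y hy) k i j)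
  have he := (Real.exp_pos (2 * u x)).ne'
  have h1 : riemannTensor (conformalChange u flatMetric) 0 0 1 1 x = -laplace u x := by
    simp only [riemannTensor, hc, christoffel_conformalChange (hd x hx), laplace]
    simp [partialDeriv_neg]
    ring
  simp only [gaussCurvature, Fin.sum_univ_two, h1, det_conformalChange_flatMetric,
    conformalChange_flatMetric]
  simp
  field_simp

/-! ### Transport of a density on the line -/

theorem strictMono_sub_sin_mul_cos : StrictMono fun θ : ℝ => θ - Real.sin θ * Real.cos θ := by
  intro a b hab
  have h1 : Real.sin b * Real.cos b - Real.sin a * Real.cos a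
      = Real.sin (b - a) * Real.cos (b + a) := by
    rw [Real.sin_sub, Real.cos_add]
    linear_combination (-Real.sin b * Real.cos b) * Real.sin_sq_add_cos_sq a
      + (Real.sin a * Real.cos a) * Real.sin_sq_add_cos_sq b
  have h2 : |Real.sin (b - a)| < b - a :=
    (Real.abs_sin_lt_abs (sub_pos.2 hab).ne').trans_eq (abs_of_pos (sub_pos.2 hab))
  have h3 : Real.sin (b - a) * Real.cos (b + a) ≤ |Real.sin (b - a)| := by
    refine (le_abs_self _).trans ?_
    rw [abs_mul]
    exact mul_le_of_le_one_right (abs_nonneg _) (Real.abs_cos_le_one _)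
  simp only
  linarith

/-- The unit disk has area `θ - sin θ cos θ` to the left of the abscissa `-cos θ`. The inverse
`ψ` of this function of `θ` transports the uniform density on `[0, π]` to the first marginal of
the disk; it is differentiable off the two poles. -/
theorem exists_diskAngle : ∃ ψ : ℝ → ℝ, Continuous ψ ∧ StrictMono ψ ∧ ψ 0 = 0 ∧
    ψ Real.pi = Real.pi ∧
    ∀ s, Real.sin (ψ s) ≠ 0 → HasDerivAt ψ (2 * Real.sin (ψ s) ^ 2)⁻¹ s := by
  set A : ℝ → ℝ := fun θ => θ - Real.sin θ * Real.cos θ with hA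
  have hb : ∀ θ, |Real.sin θ * Real.cos θ| ≤ 1 := fun θ => by
    rw [abs_mul]
    exact mul_le_one₀ (Real.abs_sin_le_one θ) (abs_nonneg _) (Real.abs_cos_le_one θ)
  have hs : Function.Surjective A := by
    apply Continuous.surjective (by fun_prop)
    · exact Filter.tendsto_atTop_mono (fun θ => by
          simp only [id_eq, hA]; linarith [(abs_le.1 (hb θ)).2])
        (Filter.tendsto_atTop_add_const_right _ (-1) Filter.tendsto_id)
    · exact Filter.tendsto_atBot_mono (fun θ => by
          simp only [id_eq, hA]; linarith [(abs_le.1 (hb θ)).1])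
        (Filter.tendsto_atBot_add_const_right _ 1 Filter.tendsto_id)
  let e := StrictMono.orderIsoOfSurjective A strictMono_sub_sin_mul_cos hs
  have he : ∀ s, A (e.symm s) = s := e.apply_symm_apply
  have he' : ∀ s, e.symm (A s) = s := e.symm_apply_apply
  refine ⟨e.symm, e.symm.continuous, e.symm.strictMono, ?_, ?_, fun s hs => ?_⟩
  · simpa [hA] using he' 0
  · simpa [hA] using he' Real.pi
  · refine HasDerivAt.of_local_left_inverse (f := A) e.symm.continuous.continuousAt ?_
      (by positivity) (Filter.Eventually.of_forall he)
    have h : HasDerivAt A (1 - (Real.cos (e.symm s) * Real.cos (e.symm s)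
        + Real.sin (e.symm s) * -Real.sin (e.symm s))) (e.symm s) := (hasDerivAt_id _).sub
      ((Real.hasDerivAt_sin (e.symm s)).mul (Real.hasDerivAt_cos (e.symm s)))
    refine h.congr_deriv ?_
    nlinarith [Real.sin_sq_add_cos_sq (e.symm s)]

/-- A product `f * g` is differentiable at a zero of `f` as soon as `f` is differentiable and
`g` is continuous there. -/
theorem HasDerivAt.mul_continuousAt_of_eq_zero {f g : ℝ → ℝ} {f' x : ℝ} (hf : HasDerivAt f f' x)
    (hg : ContinuousAt g x) (h0 : f x = 0) : HasDerivAt (fun y => f y * g y) (f' * g x) x := by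
  rw [hasDerivAt_iff_tendsto_slope] at hf ⊢
  refine (hf.mul (hg.tendsto.mono_left nhdsWithin_le_nhds)).congr fun y => ?_
  simp only [slope_def_field, h0]
  ring

theorem hasDerivAt_primitive {f : ℝ → ℝ} (hf : Continuous f) (a x : ℝ) :
    HasDerivAt (fun u => ∫ t in a..u, f t) (f x) x :=
  intervalIntegral.integral_hasDerivAt_right (hf.intervalIntegrable _ _)
    (hf.stronglyMeasurableAtFilter _ _) hf.continuousAt

/-- Integration by parts against the affine rearrangement `ρ (2 N / D - 1)` of the density
`w ^ 2`. -/
theorem integral_mul_deriv_uniformTransport {w w' : ℝ → ℝ} (hw' : Continuous w')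
    (hd : ∀ y, HasDerivAt w (w' y) y) {R : ℝ} (h1 : w (-R) = 0) (h2 : w R = 0) (ρ D : ℝ) :
    ∫ y in (-R)..R, w y * (2 * ρ * w y ^ 2 / D)
      = -∫ y in (-R)..R, w' y * (ρ * (2 * (∫ t in (-R)..y, w t ^ 2) / D - 1)) := by
  have hw : Continuous w := continuous_iff_continuousAt.2 fun y => (hd y).continuousAt
  have hT : ∀ y, HasDerivAt (fun y => ρ * (2 * (∫ t in (-R)..y, w t ^ 2) / D - 1))
      (2 * ρ * w y ^ 2 / D) y := fun y => by
    refine (((((hasDerivAt_primitive (hw.pow 2) (-R) y).const_mul 2).div_const D).sub_const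
      1).const_mul ρ).congr_deriv ?_
    simp only [Pi.pow_apply]
    ring
  rw [intervalIntegral.integral_mul_deriv_eq_deriv_mul (fun y _ => hd y) (fun y _ => hT y)
    (hw'.intervalIntegrable _ _)
    ((by fun_prop : Continuous fun y => 2 * ρ * w y ^ 2 / D).intervalIntegrable _ _), h1, h2]
  ring

/-- Let `θ` be the angle for which the part of the disk left of `-cos θ` has the same share of the
total area as `[-R, x]` has of the mass of `D`. Then `θ ∈ [0, π]`, and a pole can be reached only
at a point where the density `D` vanishes. -/
theorem diskAngle_bounds {ψ : ℝ → ℝ} (hψm : StrictMono ψ) (hψ0 : ψ 0 = 0)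
    (hψπ : ψ Real.pi = Real.pi) {D : ℝ → ℝ} (hD : Continuous D) (hD0 : ∀ x, 0 ≤ D x) {R : ℝ}
    (hD1 : D (-R) = 0) (hD2 : D R = 0) (hM : 0 < ∫ t in (-R)..R, D t) {x : ℝ}
    (hx : x ∈ Set.Icc (-R) R) :
    let s := Real.sin (ψ (Real.pi * (∫ t in (-R)..x, D t) / ∫ t in (-R)..R, D t))
    0 ≤ s ∧ (s = 0 → D x = 0) := by
  intro s
  set M := ∫ t in (-R)..R, D t
  set F := ∫ t in (-R)..x, D t with hF
  have hsum : F + ∫ t in x..R, D t = M := intervalIntegral.integral_add_adjacent_intervals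
    (hD.intervalIntegrable _ _) (hD.intervalIntegrable _ _)
  have hF0 : 0 ≤ F := intervalIntegral.integral_nonneg hx.1 fun t _ => hD0 t
  have hFM : 0 ≤ ∫ t in x..R, D t := intervalIntegral.integral_nonneg hx.2 fun t _ => hD0 t
  have ha : 0 ≤ Real.pi * F / M := by positivity
  have hb : Real.pi * F / M ≤ Real.pi := by
    rw [div_le_iff₀ hM]
    exact mul_le_mul_of_nonneg_left (by linarith) Real.pi_pos.le
  have hθ0 : 0 ≤ ψ (Real.pi * F / M) := hψ0 ▸ hψm.monotone ha
  have hθπ : ψ (Real.pi * F / M) ≤ Real.pi := by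
    have := hψm.monotone hb
    rwa [hψπ] at this
  refine ⟨Real.sin_nonneg_of_nonneg_of_le_pi hθ0 hθπ, fun hs => ?_⟩
  by_contra hne
  have hpos : 0 < D x := lt_of_le_of_ne (hD0 x) (Ne.symm hne)
  have hx1 : -R < x := lt_of_le_of_ne hx.1 fun h => hne (h ▸ hD1)
  have hx2 : x < R := lt_of_le_of_ne hx.2 fun h => hne (h ▸ hD2)
  have hF1 : 0 < F := intervalIntegral.integral_pos hx1 hD.continuousOn (fun t _ => hD0 t)
    ⟨x, ⟨hx1.le, le_rfl⟩, hpos⟩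
  have hF2 : 0 < ∫ t in x..R, D t := intervalIntegral.integral_pos hx2 hD.continuousOn
    (fun t _ => hD0 t) ⟨x, ⟨le_rfl, hx2.le⟩, hpos⟩
  have h1 : 0 < ψ (Real.pi * F / M) := hψ0 ▸ hψm (by positivity)
  have h2 : ψ (Real.pi * F / M) < Real.pi := by
    have : Real.pi * F / M < Real.pi := by
      rw [div_lt_iff₀ hM]
      exact mul_lt_mul_of_pos_left (by linarith) Real.pi_pos
    have := hψm this
    rwa [hψπ] at this
  exact (Real.sin_pos_of_pos_of_lt_pi h1 h2).ne' hs

/-- Integration by parts against the map `-cos θ` that carries the density `D` to the first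
marginal of the disk. The map need not be differentiable at the poles `sin θ = 0`, but `w`
vanishes there. -/
theorem integral_mul_deriv_diskTransport {ψ : ℝ → ℝ} (hψc : Continuous ψ) (hψm : StrictMono ψ)
    (hψ0 : ψ 0 = 0) (hψπ : ψ Real.pi = Real.pi)
    (hψd : ∀ s, Real.sin (ψ s) ≠ 0 → HasDerivAt ψ (2 * Real.sin (ψ s) ^ 2)⁻¹ s)
    {D : ℝ → ℝ} (hD : Continuous D) (hD0 : ∀ x, 0 ≤ D x) {R : ℝ} (hR : 0 < R)
    (hD1 : D (-R) = 0) (hD2 : D R = 0) (hM : 0 < ∫ t in (-R)..R, D t)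
    {w w' : ℝ → ℝ} (hw0 : ∀ x, 0 ≤ w x) (hw' : Continuous w')
    (hd : ∀ x, HasDerivAt w (w' x) x) (hwD : ∀ x, D x = 0 → w x = 0) :
    let θ := fun x => ψ (Real.pi * (∫ t in (-R)..x, D t) / ∫ t in (-R)..R, D t)
    let B := fun x => w x * (Real.pi * D x / (2 * (∫ t in (-R)..R, D t) * Real.sin (θ x)))
    IntervalIntegrable B volume (-R) R ∧
      ∫ x in (-R)..R, B x = -∫ x in (-R)..R, w' x * -Real.cos (θ x) := by
  intro θ B
  set M := ∫ t in (-R)..R, D t with hMdef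
  have hF : ∀ x, HasDerivAt (fun x => Real.pi * (∫ t in (-R)..x, D t) / M)
      (Real.pi * D x / M) x := fun x =>
    ((hasDerivAt_primitive hD (-R) x).const_mul _).div_const _
  have hθc : Continuous θ := hψc.comp (continuous_iff_continuousAt.2 fun x => (hF x).continuousAt)
  have hsin : ∀ x ∈ Set.Icc (-R) R, 0 ≤ Real.sin (θ x) ∧ (Real.sin (θ x) = 0 → D x = 0) :=
    fun x hx => diskAngle_bounds hψm hψ0 hψπ hD hD0 hD1 hD2 hM hx
  have hprod : ∀ x ∈ Set.Icc (-R) R,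
      HasDerivAt (fun x => w x * -Real.cos (θ x)) (w' x * -Real.cos (θ x) + B x) x := by
    intro x hx
    by_cases hs : Real.sin (θ x) = 0
    · have h0 : w x = 0 := hwD x ((hsin x hx).2 hs)
      have hB : B x = 0 := by simp [B, h0]
      rw [hB, add_zero]
      exact (hd x).mul_continuousAt_of_eq_zero
        (g := fun x => -Real.cos (θ x)) (by fun_prop) h0
    · have h : HasDerivAt (fun x => -Real.cos (θ x))
          (-(-Real.sin (θ x) * ((2 * Real.sin (θ x) ^ 2)⁻¹ * (Real.pi * D x / M)))) x :=
        ((hψd _ hs).comp x (hF x)).cos.neg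
      refine ((hd x).mul h).congr_deriv ?_
      simp only [B, ← hMdef]
      generalize Real.sin (θ x) = S at hs
      field_simp
  have hP : ∀ x, HasDerivAt (fun x => ∫ t in (-R)..x, w' t * -Real.cos (θ t))
      (w' x * -Real.cos (θ x)) x := hasDerivAt_primitive (by fun_prop) (-R)
  have hH : ∀ x ∈ Set.Icc (-R) R, HasDerivAt (fun x => w x * -Real.cos (θ x)
      - ∫ t in (-R)..x, w' t * -Real.cos (θ t)) (B x) x := fun x hx => by
    refine ((hprod x hx).sub (hP x)).congr_deriv (by ring)
  have hle : -R ≤ R := by linarith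
  have hint : IntervalIntegrable B volume (-R) R := by
    refine intervalIntegral.intervalIntegrable_deriv_of_nonneg
      (g := fun x => w x * -Real.cos (θ x) - ∫ t in (-R)..x, w' t * -Real.cos (θ t)) ?_ ?_ ?_
    · rw [Set.uIcc_of_le hle]
      exact fun x hx => (hH x hx).continuousAt.continuousWithinAt
    · rw [min_eq_left hle, max_eq_right hle]
      exact fun x hx => hH x (Set.Ioo_subset_Icc_self hx)
    · rw [min_eq_left hle, max_eq_right hle]
      intro x hx
      have := (hsin x (Set.Ioo_subset_Icc_self hx)).1
      have := hw0 x
      have := hD0 x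
      have := Real.pi_pos
      positivity
  refine ⟨hint, ?_⟩
  rw [intervalIntegral.integral_eq_sub_of_hasDerivAt
    (by rw [Set.uIcc_of_le hle]; exact hH) hint, hwD R hD2, hwD (-R) hD1]
  simp

/-! ### The sharp Sobolev inequality in the plane -/

/-- A nonnegative function on `α × β` all of whose slice integrals agree with those of an
integrable function is integrable, and the two functions have the same integral. -/
theorem integrable_prod_of_integral_slice_eq {α β : Type*} [MeasurableSpace α]
    [MeasurableSpace β] {μ : Measure α} {ν : Measure β} [SFinite μ] [SFinite ν] {f g : α × β → ℝ}
    (hf : AEStronglyMeasurable f (μ.prod ν)) (hf0 : ∀ᵐ x ∂μ, ∀ᵐ y ∂ν, 0 ≤ f (x, y))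
    (hfi : ∀ᵐ x ∂μ, Integrable (fun y => f (x, y)) ν) (hg : Integrable g (μ.prod ν))
    (h : ∀ᵐ x ∂μ, ∫ y, f (x, y) ∂ν = ∫ y, g (x, y) ∂ν) :
    Integrable f (μ.prod ν) ∧ ∫ z, f z ∂μ.prod ν = ∫ z, g z ∂μ.prod ν := by
  have hI : Integrable f (μ.prod ν) := by
    rw [integrable_prod_iff hf]
    refine ⟨hfi, hg.integral_prod_left.congr ?_⟩
    filter_upwards [h, hf0] with x hx hx0
    rw [← hx]
    refine integral_congr_ae ?_
    filter_upwards [hx0] with y hy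
    rw [Real.norm_of_nonneg hy]
  refine ⟨hI, ?_⟩
  rw [integral_prod f hI, integral_prod g hg]
  exact integral_congr_ae h

/-- The sharp Sobolev inequality `4π ∫ w² ≤ (∫ |∇w|)²` for `w ≥ 0` supported in a square. The
proof transports the density `w²` to the uniform density on the unit disk by a Knothe map
`T = (T₁(x), T₂(x, y))`. Its Jacobian `∂ₓT₁ ∂ᵧT₂ = π w² / ∫ w²` gives `div T ≥ 2 w √(π / ∫ w²)`
by the inequality of means, and `∫ w div T = -∫ ∇w · T ≤ ∫ |∇w|` because `|T| ≤ 1`. -/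
theorem sobolev_square {w wx wy : ℝ → ℝ → ℝ} (hw : Continuous (Function.uncurry w))
    (hwx : Continuous (Function.uncurry wx)) (hwy : Continuous (Function.uncurry wy))
    (hdx : ∀ x y, HasDerivAt (fun x => w x y) (wx x y) x)
    (hdy : ∀ x y, HasDerivAt (fun y => w x y) (wy x y) y) (hw0 : ∀ x y, 0 ≤ w x y)
    {R : ℝ} (hR : 0 < R) (hRx : ∀ x y, R ≤ |x| → w x y = 0) (hRy : ∀ x y, R ≤ |y| → w x y = 0) :
    let ν := (volume : Measure ℝ).restrict (Set.Ioc (-R) R)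
    4 * Real.pi * ∫ z, w z.1 z.2 ^ 2 ∂ν.prod ν
      ≤ (∫ z, Real.sqrt (wx z.1 z.2 ^ 2 + wy z.1 z.2 ^ 2) ∂ν.prod ν) ^ 2 := by
  intro ν
  have hRR : -R ≤ R := by linarith
  have habs : |(-R)| = R := by rw [abs_neg, abs_of_pos hR]
  have hii : ∀ f : ℝ → ℝ, ∫ t in (-R)..R, f t = ∫ t, f t ∂ν := fun f =>
    intervalIntegral.integral_of_le hRR
  have hbdd : ∀ f : ℝ × ℝ → ℝ, Continuous f → Integrable f (ν.prod ν) := by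
    intro f hf
    have : IntegrableOn f (Set.Icc (-R) R ×ˢ Set.Icc (-R) R) (volume.prod volume) :=
      hf.continuousOn.integrableOn_compact (isCompact_Icc.prod isCompact_Icc)
    rw [Measure.prod_restrict]
    exact this.mono_set (Set.prod_mono Set.Ioc_subset_Icc_self Set.Ioc_subset_Icc_self)
  have hw2 : Continuous (Function.uncurry fun x y => w x y ^ 2) := hw.pow 2
  have hsl : ∀ x, Continuous (w x) := fun x => hw.comp (Continuous.prodMk_right x)
  -- the mass of the vertical slices, and its part below height `y`
  set D : ℝ → ℝ := fun x => ∫ t in (-R)..R, w x t ^ 2 with hDdef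
  set N : ℝ → ℝ → ℝ := fun x y => ∫ t in (-R)..y, w x t ^ 2 with hNdef
  have hDc : Continuous D :=
    intervalIntegral.continuous_parametric_intervalIntegral_of_continuous hw2 continuous_const
  have hNc : Continuous fun z : ℝ × ℝ => N z.1 z.2 :=
    intervalIntegral.continuous_parametric_intervalIntegral_of_continuous
      (f := fun (z : ℝ × ℝ) t => w z.1 t ^ 2)
      (hw2.comp ((continuous_fst.comp continuous_fst).prodMk continuous_snd)) continuous_snd
  have hD0 : ∀ x, 0 ≤ D x := fun x =>
    intervalIntegral.integral_nonneg hRR fun t _ => sq_nonneg _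
  have hDw : ∀ x y, D x = 0 → w x y = 0 := by
    intro x y hx
    by_contra hne
    have hy : |y| < R := not_le.1 fun h => hne (hRy x y h)
    have : 0 < D x := intervalIntegral.integral_pos (by linarith) ((hsl x).pow 2).continuousOn
      (fun t _ => sq_nonneg _) ⟨y, ⟨(abs_lt.1 hy).1.le, (abs_lt.1 hy).2.le⟩, by positivity⟩
    exact this.ne' hx
  have hDR : ∀ x, R ≤ |x| → D x = 0 := fun x hx => by simp [hDdef, hRx x _ hx]
  set M := ∫ x in (-R)..R, D x with hMdef
  have hM : ∫ z, w z.1 z.2 ^ 2 ∂ν.prod ν = M := by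
    rw [integral_prod (fun z : ℝ × ℝ => w z.1 z.2 ^ 2) (hbdd _ hw2), hMdef, hii]
    simp only [hDdef, hii]
  have hM0 : 0 ≤ M := intervalIntegral.integral_nonneg hRR fun t _ => hD0 t
  rw [hM]
  rcases hM0.eq_or_lt with hM0 | hMpos
  · rw [← hM0, mul_zero]
    positivity
  obtain ⟨ψ, hψc, hψm, hψ0, hψπ, hψd⟩ := exists_diskAngle
  set θ : ℝ → ℝ := fun x => ψ (Real.pi * (∫ t in (-R)..x, D t) / M) with hθdef
  have hθc : Continuous θ := by
    refine hψc.comp (continuous_iff_continuousAt.2 fun x => ?_)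
    exact (((hasDerivAt_primitive hDc (-R) x).const_mul _).div_const _).continuousAt
  set ρ : ℝ → ℝ := fun x => Real.sin (θ x) with hρdef
  have hρc : Continuous ρ := Real.continuous_sin.comp hθc
  have hρ : ∀ x ∈ Set.Icc (-R) R, 0 ≤ ρ x ∧ (ρ x = 0 → D x = 0) := fun x hx =>
    diskAngle_bounds hψm hψ0 hψπ hDc hD0 (hDR _ habs.ge) (hDR _ (le_abs_self R)) hMpos hx
  -- `A = w ∂ᵧT₂` and `B = w ∂ₓT₁`
  set A : ℝ × ℝ → ℝ := fun z => w z.1 z.2 * (2 * ρ z.1 * w z.1 z.2 ^ 2 / D z.1) with hAdef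
  set B : ℝ × ℝ → ℝ := fun z => w z.1 z.2 * (Real.pi * D z.1 / (2 * M * ρ z.1)) with hBdef
  set T₁ : ℝ × ℝ → ℝ := fun z => -Real.cos (θ z.1) with hT₁
  set T₂ : ℝ × ℝ → ℝ := fun z => ρ z.1 * (2 * N z.1 z.2 / D z.1 - 1) with hT₂
  have hmem : ∀ᵐ x ∂ν, x ∈ Set.Icc (-R) R := by
    filter_upwards [ae_restrict_mem measurableSet_Ioc] with x hx
    exact Set.Ioc_subset_Icc_self hx
  have hmemp : ∀ᵐ z ∂ν.prod ν, z.1 ∈ Set.Icc (-R) R ∧ z.2 ∈ Set.Icc (-R) R := by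
    rw [show ν.prod ν = _ from Measure.prod_restrict _ _]
    filter_upwards [ae_restrict_mem (measurableSet_Ioc.prod measurableSet_Ioc)] with z hz
    exact ⟨Set.Ioc_subset_Icc_self hz.1, Set.Ioc_subset_Icc_self hz.2⟩
  have hwm : Measurable fun z : ℝ × ℝ => w z.1 z.2 := hw.measurable
  have hDm : Measurable fun z : ℝ × ℝ => D z.1 := hDc.measurable.comp measurable_fst
  have hρm : Measurable fun z : ℝ × ℝ => ρ z.1 := hρc.measurable.comp measurable_fst
  have hAm : Measurable A := hwm.mul (((hρm.const_mul 2).mul (hwm.pow_const 2)).div hDm)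
  have hBm : Measurable B := hwm.mul ((hDm.const_mul _).div (hρm.const_mul _))
  have hT₁c : Continuous T₁ := (Real.continuous_cos.comp (hθc.comp continuous_fst)).neg
  have hT₂m : Measurable T₂ := hρm.mul (((hNc.measurable.const_mul 2).div hDm).sub_const 1)
  have hT : ∀ z : ℝ × ℝ, z.2 ∈ Set.Icc (-R) R → T₁ z ^ 2 + T₂ z ^ 2 ≤ 1 := by
    intro z hz
    have h1 : 0 ≤ N z.1 z.2 := intervalIntegral.integral_nonneg hz.1 fun t _ => sq_nonneg _
    have h2 : N z.1 z.2 ≤ D z.1 := by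
      have h := intervalIntegral.integral_add_adjacent_intervals (μ := volume)
        (((hsl z.1).pow 2).intervalIntegrable (-R) z.2)
        (((hsl z.1).pow 2).intervalIntegrable z.2 R)
      have h' : 0 ≤ ∫ t in z.2..R, w z.1 t ^ 2 :=
        intervalIntegral.integral_nonneg hz.2 fun t _ => sq_nonneg _
      simp only [hNdef, hDdef]
      simp only [Pi.pow_apply] at h
      linarith
    have h3 : 0 ≤ N z.1 z.2 / D z.1 := div_nonneg h1 (hD0 _)
    have h4 : N z.1 z.2 / D z.1 ≤ 1 := div_le_one_of_le₀ h2 (hD0 _)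
    have h5 : (2 * N z.1 z.2 / D z.1 - 1) ^ 2 ≤ 1 := by
      rw [mul_div_assoc]
      nlinarith
    have h6 := Real.sin_sq_add_cos_sq (θ z.1)
    simp only [hT₁, hT₂, hρdef]
    nlinarith [sq_nonneg (Real.sin (θ z.1))]
  have hTb : ∀ᵐ z ∂ν.prod ν, T₁ z ^ 2 + T₂ z ^ 2 ≤ 1 := hmemp.mono fun z hz => hT z hz.2
  have hgx : Integrable (fun z => -(wx z.1 z.2 * T₁ z)) (ν.prod ν) :=
    hbdd _ (hwx.mul hT₁c).neg
  have hgy : Integrable (fun z => -(wy z.1 z.2 * T₂ z)) (ν.prod ν) := by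
    refine ((hbdd _ hwy).mul_bdd (c := 1) hT₂m.aestronglyMeasurable ?_).neg
    filter_upwards [hTb] with z hz
    rw [Real.norm_eq_abs]
    exact abs_le_one_iff_mul_self_le_one.2 (by nlinarith [sq_nonneg (T₁ z)])
  have hA : Integrable A (ν.prod ν) ∧
      ∫ z, A z ∂ν.prod ν = ∫ z, -(wy z.1 z.2 * T₂ z) ∂ν.prod ν := by
    refine integrable_prod_of_integral_slice_eq hAm.aestronglyMeasurable ?_ ?_ hgy ?_
    · filter_upwards [hmem] with x hx
      refine Filter.Eventually.of_forall fun y => ?_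
      have := hw0 x y
      have := hD0 x
      have := (hρ x hx).1
      simp only [hAdef]
      positivity
    · refine Filter.Eventually.of_forall fun x => ?_
      have hc : Continuous fun y => A (x, y) := by
        have := hsl x
        simp only [hAdef]
        fun_prop
      exact hc.integrableOn_Ioc
    · refine Filter.Eventually.of_forall fun x => ?_
      have h := integral_mul_deriv_uniformTransport (w := w x) (w' := wy x)
        (hwy.comp (Continuous.prodMk_right x)) (hdy x) (R := R) (hRy _ _ habs.ge)
        (hRy _ _ (le_abs_self R)) (ρ x) (D x)
      rw [hii, hii] at h
      rw [integral_neg]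
      exact h
  have hB : Integrable B (ν.prod ν) ∧
      ∫ z, B z ∂ν.prod ν = ∫ z, -(wx z.1 z.2 * T₁ z) ∂ν.prod ν := by
    have hx := fun y => integral_mul_deriv_diskTransport hψc hψm hψ0 hψπ hψd hDc hD0 hR
      (hDR _ habs.ge) (hDR _ (le_abs_self R)) hMpos (w := fun x => w x y)
      (w' := fun x => wx x y) (fun x => hw0 x y) (hwx.comp (Continuous.prodMk_left y))
      (fun x => hdx x y) (fun x hx => hDw x y hx)
    have h := integrable_prod_of_integral_slice_eq (μ := ν) (ν := ν)
      (f := fun z => B z.swap) (g := fun z => -(wx z.swap.1 z.swap.2 * T₁ z.swap))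
      (hBm.comp measurable_swap).aestronglyMeasurable ?_ ?_ hgx.swap ?_
    · refine ⟨by simpa using! h.1.swap, ?_⟩
      have h2 := h.2
      rwa [integral_prod_swap (f := B),
        integral_prod_swap (f := fun z => -(wx z.1 z.2 * T₁ z))] at h2
    · refine Filter.Eventually.of_forall fun y => ?_
      filter_upwards [hmem] with x hx
      have := hw0 x y
      have := hD0 x
      have := (hρ x hx).1
      have := Real.pi_pos
      simp only [hBdef, Prod.swap]
      positivity
    · refine Filter.Eventually.of_forall fun y => ?_
      exact (intervalIntegrable_iff_integrableOn_Ioc_of_le hRR).1 (hx y).1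
    · refine Filter.Eventually.of_forall fun y => ?_
      rw [integral_neg, ← hii, ← hii]
      exact (hx y).2
  set c := Real.sqrt (Real.pi / M) with hc
  have hc2 : c ^ 2 = Real.pi / M := Real.sq_sqrt (by positivity)
  have hc0 : 0 ≤ c := Real.sqrt_nonneg _
  have hlow : 2 * c * M ≤ ∫ z, (A z + B z) ∂ν.prod ν := by
    rw [← hM, ← integral_const_mul]
    refine integral_mono_ae ((hbdd _ hw2).const_mul _) (hA.1.add hB.1) ?_
    filter_upwards [hmemp] with z hz
    rcases (hw0 z.1 z.2).eq_or_lt with h0 | hpos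
    · simp [hAdef, hBdef, ← h0]
    have hDpos : 0 < D z.1 := lt_of_le_of_ne (hD0 _) fun h => hpos.ne' (hDw _ _ h.symm)
    have hρpos : 0 < ρ z.1 := lt_of_le_of_ne (hρ _ hz.1).1
      fun h => hDpos.ne' ((hρ _ hz.1).2 h.symm)
    have hs : 2 * c * w z.1 z.2 ≤ 2 * ρ z.1 * w z.1 z.2 ^ 2 / D z.1
        + Real.pi * D z.1 / (2 * M * ρ z.1) := by
      set a := 2 * ρ z.1 * w z.1 z.2 ^ 2 / D z.1
      set b := Real.pi * D z.1 / (2 * M * ρ z.1)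
      have ha : 0 ≤ a := by positivity
      have hb : 0 ≤ b := by positivity
      have hab : a * b = (c * w z.1 z.2) ^ 2 := by
        rw [mul_pow, hc2]
        simp only [a, b]
        field_simp
      exact (sq_le_sq₀ (by positivity) (by positivity)).1 (by nlinarith [sq_nonneg (a - b)])
    calc 2 * c * w z.1 z.2 ^ 2 = w z.1 z.2 * (2 * c * w z.1 z.2) := by ring
      _ ≤ _ := mul_le_mul_of_nonneg_left hs hpos.le
      _ = A z + B z := by simp only [hAdef, hBdef]; ring
  have hup : ∫ z, (A z + B z) ∂ν.prod ν
      ≤ ∫ z, Real.sqrt (wx z.1 z.2 ^ 2 + wy z.1 z.2 ^ 2) ∂ν.prod ν := by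
    rw [integral_add hA.1 hB.1, hA.2, hB.2, ← integral_add hgy hgx]
    refine integral_mono_ae (hgy.add hgx)
      (hbdd _ (Real.continuous_sqrt.comp ((hwx.pow 2).add (hwy.pow 2)))) ?_
    filter_upwards [hTb] with z hz
    refine Real.le_sqrt_of_sq_le ?_
    nlinarith [sq_nonneg (wy z.1 z.2 * T₁ z - wx z.1 z.2 * T₂ z),
      sq_nonneg (wx z.1 z.2), sq_nonneg (wy z.1 z.2)]
  have hfin : (2 * c * M) ^ 2 ≤ _ := pow_le_pow_left₀ (by positivity) (hlow.trans hup) 2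
  calc 4 * Real.pi * M = (2 * c * M) ^ 2 := by
        rw [mul_pow, mul_pow, hc2]
        field_simp
        norm_num
    _ ≤ _ := hfin

/-- The squared Euclidean length of the gradient. -/
noncomputable def gradSq (f : Plane → ℝ) (x : Plane) : ℝ :=
  partialDeriv 0 f x ^ 2 + partialDeriv 1 f x ^ 2

theorem gradSq_nonneg (f : Plane → ℝ) (x : Plane) : 0 ≤ gradSq f x := by
  unfold gradSq
  positivity

/-- The sharp Sobolev inequality `4π ∫ w² ≤ (∫ |∇w|)²` for nonnegative `C¹` functions with
compact support in the plane. -/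
theorem sobolev_plane {w : Plane → ℝ} (hw : ContDiff ℝ 1 w) (hc : HasCompactSupport w)
    (h0 : ∀ x, 0 ≤ w x) :
    4 * Real.pi * ∫ x, w x ^ 2 ≤ (∫ x, Real.sqrt (gradSq w x)) ^ 2 := by
  set Φ : ℝ × ℝ → Plane := fun z =>
    z.1 • EuclideanSpace.single 0 1 + z.2 • EuclideanSpace.single 1 1 with hΦ
  have hΦc : Continuous Φ := by fun_prop
  have hpd : ∀ i, Continuous (partialDeriv i w) := fun i =>
    (hw.continuous_fderiv (by norm_num)).clm_apply continuous_const
  obtain ⟨R, hR, hsub⟩ := hc.isCompact.isBounded.subset_ball_lt 0 0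
  have hout : ∀ z : ℝ × ℝ, R ≤ |z.1| ∨ R ≤ |z.2| → Φ z ∉ tsupport w := by
    intro z hz hmem
    have hn := mem_ball_zero_iff.1 (hsub hmem)
    have h1 := (PiLp.norm_apply_le (Φ z) 0).trans_lt hn
    have h2 := (PiLp.norm_apply_le (Φ z) 1).trans_lt hn
    simp [hΦ] at h1 h2
    rcases hz with hz | hz <;> linarith
  have hwz : ∀ z : ℝ × ℝ, R ≤ |z.1| ∨ R ≤ |z.2| → w (Φ z) = 0 := fun z hz =>
    image_eq_zero_of_notMem_tsupport (hout z hz)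
  have hgz : ∀ z : ℝ × ℝ, R ≤ |z.1| ∨ R ≤ |z.2| → gradSq w (Φ z) = 0 := fun z hz => by
    have : fderiv ℝ w (Φ z) = 0 := by
      by_contra h
      exact hout z hz (support_fderiv_subset ℝ h)
    simp [gradSq, partialDeriv, this]
  have hder : ∀ (i : Fin 2) (l : ℝ → Plane) (c : Plane) (s : ℝ),
      l = (fun s => s • EuclideanSpace.single i 1 + c) →
      HasDerivAt (fun s => w (l s)) (partialDeriv i w (l s)) s := by
    intro i l c s hl
    have hd : HasDerivAt l (EuclideanSpace.single i 1) s := by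
      rw [hl]
      simpa using ((hasDerivAt_id s).smul_const (EuclideanSpace.single i (1 : ℝ))).add_const c
    exact ((hw.differentiable (by norm_num)) (l s)).hasFDerivAt.comp_hasDerivAt s hd
  have key := sobolev_square (w := fun x y => w (Φ (x, y)))
    (wx := fun x y => partialDeriv 0 w (Φ (x, y))) (wy := fun x y => partialDeriv 1 w (Φ (x, y)))
    (hw.continuous.comp hΦc) ((hpd 0).comp hΦc) ((hpd 1).comp hΦc)
    (fun x y => hder 0 (fun x => Φ (x, y)) (y • EuclideanSpace.single 1 1) x rfl)
    (fun x y => hder 1 (fun y => Φ (x, y)) (x • EuclideanSpace.single 0 1) y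
      (funext fun s => add_comm _ _))
    (fun x y => h0 _) hR (fun x y h => hwz (x, y) (Or.inl h)) (fun x y h => hwz (x, y) (Or.inr h))
  -- the square carries the whole integral, and `Φ` preserves the Lebesgue measure
  have htrans : ∀ F : Plane → ℝ, (∀ z : ℝ × ℝ, R ≤ |z.1| ∨ R ≤ |z.2| → F (Φ z) = 0) →
      ∫ z, F (Φ (z.1, z.2)) ∂((volume : Measure ℝ).restrict (Set.Ioc (-R) R)).prod
        ((volume : Measure ℝ).restrict (Set.Ioc (-R) R)) = ∫ x, F x := by
    intro F hF
    rw [Measure.prod_restrict, setIntegral_eq_integral_of_forall_compl_eq_zero]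
    · have hmp := (EuclideanSpace.volume_preserving_symm_measurableEquiv_toLp (Fin 2)).trans
        (volume_preserving_finTwoArrow ℝ)
      rw [← Measure.volume_eq_prod, ← MeasurePreserving.integral_comp' (f :=
        (MeasurableEquiv.toLp 2 (Fin 2 → ℝ)).symm.trans MeasurableEquiv.finTwoArrow) hmp]
      congr 1
      ext x
      congr 1
      ext i
      fin_cases i <;> simp [hΦ]
    · intro z hz
      refine hF z ?_
      by_contra! h
      exact hz ⟨⟨(abs_lt.1 h.1).1, (abs_lt.1 h.1).2.le⟩, ⟨(abs_lt.1 h.2).1, (abs_lt.1 h.2).2.le⟩⟩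
  have e1 := htrans (fun x => w x ^ 2) fun z hz => by simp [hwz z hz]
  have e2 := htrans (fun x => Real.sqrt (gradSq w x)) fun z hz => by simp [hgz z hz]
  rw [← e1, ← e2]
  exact key

/-! ### Truncations of a function with compact superlevel sets -/

/-- A `C¹` truncation `φ` of the ramp that rises from `0` at `t` to `h` at `t + h`. -/
theorem exists_truncation (t : ℝ) {h ε : ℝ} (hε : 0 < ε) (hεh : ε < h) :
    ∃ φ η : ℝ → ℝ, Continuous η ∧ (∀ s, HasDerivAt φ (η s) s) ∧ (∀ s, 0 ≤ η s ∧ η s ≤ 1) ∧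
      (∀ s ≤ t, φ s = 0 ∧ η s = 0) ∧ (∀ s, t + h ≤ s → η s = 0 ∧ h - ε ≤ φ s) ∧
      ∀ s, 0 ≤ φ s ∧ φ s ≤ h := by
  set η : ℝ → ℝ := fun s => max 0 (min 1 (min (s - t) (t + h - s) / (ε / 2))) with hη
  have hηc : Continuous η := by fun_prop
  have h01 : ∀ s, 0 ≤ η s ∧ η s ≤ 1 := fun s =>
    ⟨le_max_left _ _, max_le zero_le_one (min_le_left _ _)⟩
  have hz : ∀ s, min (s - t) (t + h - s) ≤ 0 → η s = 0 := fun s hs =>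
    max_eq_left ((min_le_right _ _).trans (div_nonpos_of_nonpos_of_nonneg hs (by positivity)))
  have hone : ∀ s, t + ε / 2 ≤ s → s ≤ t + h - ε / 2 → η s = 1 := fun s h1 h2 => by
    have : 1 ≤ min (s - t) (t + h - s) / (ε / 2) := by
      rw [le_div_iff₀ (by positivity), one_mul]
      exact le_min (by linarith) (by linarith)
    simp [hη, min_eq_left this]
  have hlow : ∀ s ≤ t, η s = 0 := fun s hs => hz s (min_le_of_left_le (by linarith))
  have hhigh : ∀ s, t + h ≤ s → η s = 0 := fun s hs => hz s (min_le_of_right_le (by linarith))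
  have hint : ∀ a b, IntervalIntegrable η volume a b := fun a b => hηc.intervalIntegrable a b
  have hφ0 : ∀ s ≤ t, ∫ r in t..s, η r = 0 := fun s hs => by
    rw [intervalIntegral.integral_symm, intervalIntegral.integral_zero_ae]
    · simp
    · refine Filter.Eventually.of_forall fun r hr => hlow r ?_
      rw [Set.uIoc_of_le hs] at hr
      exact hr.2
  have hmono : ∀ a b, a ≤ b → ∫ r in t..a, η r ≤ ∫ r in t..b, η r := fun a b hab => by
    rw [← intervalIntegral.integral_add_adjacent_intervals (hint t a) (hint a b)]
    exact le_add_of_nonneg_right (intervalIntegral.integral_nonneg hab fun r _ => (h01 r).1)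
  have hconst : ∀ s, t + h ≤ s → ∫ r in t..s, η r = ∫ r in t..(t + h), η r := fun s hs => by
    rw [← intervalIntegral.integral_add_adjacent_intervals (hint t (t + h)) (hint (t + h) s),
      intervalIntegral.integral_zero_ae (a := t + h), add_zero]
    refine Filter.Eventually.of_forall fun r hr => hhigh r ?_
    rw [Set.uIoc_of_le hs] at hr
    exact hr.1.le
  have htop : ∫ r in t..(t + h), η r ≤ h := by
    calc _ ≤ ∫ _ in t..(t + h), (1 : ℝ) := intervalIntegral.integral_mono_on (by linarith)
            (hint _ _) intervalIntegrable_const fun r _ => (h01 r).2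
      _ = h := by simp
  refine ⟨fun s => ∫ r in t..s, η r, η, hηc, hasDerivAt_primitive hηc t, h01,
    fun s hs => ⟨hφ0 s hs, hlow s hs⟩, fun s hs => ⟨hhigh s hs, ?_⟩, fun s => ⟨?_, ?_⟩⟩
  · calc h - ε = ∫ _ in (t + ε / 2)..(t + h - ε / 2), (1 : ℝ) := by simp; ring
      _ = ∫ r in (t + ε / 2)..(t + h - ε / 2), η r := by
          refine intervalIntegral.integral_congr fun r hr => ?_
          rw [Set.uIcc_of_le (by linarith)] at hr
          exact (hone r hr.1 hr.2).symm
      _ ≤ ∫ r in t..(t + h), η r := by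
          refine intervalIntegral.integral_mono_interval (by linarith) (by linarith)
            (by linarith) (Filter.Eventually.of_forall fun r => (h01 r).1) (hint _ _)
      _ ≤ _ := hmono _ _ hs
  · rcases le_total s t with hs | hs
    · exact (hφ0 s hs).ge
    · exact intervalIntegral.integral_nonneg hs fun r _ => (h01 r).1
  · rcases le_total s (t + h) with hs | hs
    · exact (hmono _ _ hs).trans htop
    · exact ((hconst s hs).trans_le htop)


theorem integrable_of_continuousOn_of_eq_zero {U K : Set Plane} {F : Plane → ℝ}
    (hF : ContinuousOn F U) (hK : IsCompact K) (hKU : K ⊆ U) (h0 : ∀ x ∉ K, F x = 0) :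
    Integrable F :=
  ((hF.mono hKU).integrableOn_compact hK).integrable_of_forall_notMem_eq_zero h0

theorem contDiff_truncation {U : Set Plane} (hU : IsOpen U) {v : Plane → ℝ}
    (hv : ContDiffOn ℝ 1 v U) {t : ℝ} (hK : IsCompact {x ∈ U | t ≤ v x}) {φ η : ℝ → ℝ}
    (hη : Continuous η) (hφ : ∀ s, HasDerivAt φ (η s) s) (h0 : ∀ s ≤ t, φ s = 0) :
    ContDiff ℝ 1 (U.indicator fun x => φ (v x)) := by
  have hφ1 : ContDiff ℝ 1 φ := by
    rw [contDiff_one_iff_deriv]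
    refine ⟨fun s => (hφ s).differentiableAt, ?_⟩
    rwa [show deriv φ = η from funext fun s => (hφ s).deriv]
  rw [contDiff_iff_contDiffAt]
  intro x
  by_cases hx : x ∈ U
  · refine ((hφ1.contDiffAt.comp x (hv.contDiffAt (hU.mem_nhds hx)))).congr_of_eventuallyEq ?_
    filter_upwards [hU.mem_nhds hx] with y hy
    simp [hy]
  · refine (contDiffAt_const (c := (0 : ℝ))).congr_of_eventuallyEq ?_
    filter_upwards [hK.isClosed.isOpen_compl.mem_nhds fun h => hx h.1] with y hy
    by_cases hyU : y ∈ U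
    · rw [Set.indicator_of_mem hyU]
      exact h0 _ (not_le.1 fun h => hy ⟨hyU, h⟩).le
    · exact Set.indicator_of_notMem hyU _

theorem partialDeriv_truncation {U : Set Plane} (hU : IsOpen U) {v : Plane → ℝ}
    (hv : DifferentiableOn ℝ v U) {t : ℝ} (hK : IsCompact {x ∈ U | t ≤ v x}) {φ η : ℝ → ℝ}
    (hφ : ∀ s, HasDerivAt φ (η s) s) (h0 : ∀ s ≤ t, φ s = 0) (i : Fin 2) (x : Plane) :
    partialDeriv i (U.indicator fun x => φ (v x)) x
      = U.indicator (fun x => η (v x) * partialDeriv i v x) x := by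
  by_cases hx : x ∈ U
  · rw [Set.indicator_of_mem hx, ← partialDeriv_comp i (hφ _)
      (hv.differentiableAt (hU.mem_nhds hx))]
    refine partialDeriv_congr i ?_
    filter_upwards [hU.mem_nhds hx] with y hy
    simp [hy]
  · rw [Set.indicator_of_notMem hx, ← partialDeriv_const i 0 x]
    refine partialDeriv_congr i ?_
    filter_upwards [hK.isClosed.isOpen_compl.mem_nhds fun h => hx h.1] with y hy
    by_cases hyU : y ∈ U
    · rw [Set.indicator_of_mem hyU]
      exact h0 _ (not_le.1 fun h => hy ⟨hyU, h⟩).le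
    · exact Set.indicator_of_notMem hyU _

/-- Green's formula `∫ φ'(v) |∇v|² = -∫ φ(v) Δv` for a truncation `φ(v)` with compact support. -/
theorem integral_truncation_gradSq {U : Set Plane} (hU : IsOpen U) {v : Plane → ℝ}
    (hv : ContDiffOn ℝ 2 v U) {t : ℝ} (hK : IsCompact {x ∈ U | t ≤ v x}) {φ η : ℝ → ℝ}
    (hη : Continuous η) (hφ : ∀ s, HasDerivAt φ (η s) s) (h0 : ∀ s ≤ t, φ s = 0 ∧ η s = 0) :
    ∫ x, U.indicator (fun x => η (v x) * gradSq v x) x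
      = -∫ x, laplace v x * U.indicator (fun x => φ (v x)) x := by
  set w := U.indicator fun x => φ (v x) with hw
  have hw1 : ContDiff ℝ 1 w :=
    contDiff_truncation hU (hv.of_le (by norm_num)) hK hη hφ fun s hs => (h0 s hs).1
  have hp : ∀ i x, partialDeriv i w x = U.indicator (fun x => η (v x) * partialDeriv i v x) x :=
    partialDeriv_truncation hU (hv.differentiableOn (by norm_num)) hK hφ fun s hs => (h0 s hs).1
  have hpv : ∀ i, ContDiffOn ℝ 1 (partialDeriv i v) U := fun i =>
    contDiffOn_partialDeriv hU hv (by norm_num) i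
  have hppv : ∀ i, ContinuousOn (partialDeriv i (partialDeriv i v)) U := fun i =>
    (contDiffOn_partialDeriv (m := 0) hU (hpv i) (by norm_num) i).continuousOn
  have hKU : {x ∈ U | t ≤ v x} ⊆ U := fun x hx => hx.1
  have hw0 : ∀ x ∉ {x ∈ U | t ≤ v x}, w x = 0 := by
    intro x hx
    by_cases hxU : x ∈ U
    · rw [hw, Set.indicator_of_mem hxU]
      exact (h0 _ (not_le.1 fun h => hx ⟨hxU, h⟩).le).1
    · exact Set.indicator_of_notMem hxU _
  have hp0 : ∀ i, ∀ x ∉ {x ∈ U | t ≤ v x}, partialDeriv i w x = 0 := by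
    intro i x hx
    rw [hp]
    by_cases hxU : x ∈ U
    · rw [Set.indicator_of_mem hxU, (h0 _ (not_le.1 fun h => hx ⟨hxU, h⟩).le).2, zero_mul]
    · exact Set.indicator_of_notMem hxU _
  have hts : tsupport w ⊆ {x ∈ U | t ≤ v x} :=
    closure_minimal (fun x hx => by_contra fun h => hx (hw0 x h)) hK.isClosed
  have hpw : ∀ i, Continuous (partialDeriv i w) := fun i =>
    (hw1.continuous_fderiv (by norm_num)).clm_apply continuous_const
  have hi1 : ∀ i, Integrable fun x => partialDeriv i (partialDeriv i v) x * w x := fun i =>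
    integrable_of_continuousOn_of_eq_zero ((hppv i).mul hw1.continuous.continuousOn) hK hKU
      fun x hx => by simp [hw0 x hx]
  have hi2 : ∀ i, Integrable fun x => partialDeriv i v x * partialDeriv i w x := fun i =>
    integrable_of_continuousOn_of_eq_zero ((hpv i).continuousOn.mul (hpw i).continuousOn) hK hKU
      fun x hx => by simp [hp0 i x hx]
  have hi3 : ∀ i, Integrable fun x => partialDeriv i v x * w x := fun i =>
    integrable_of_continuousOn_of_eq_zero
      ((hpv i).continuousOn.mul hw1.continuous.continuousOn) hK hKU
      fun x hx => by simp [hw0 x hx]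
  have hibp : ∀ i, ∫ x, partialDeriv i v x * partialDeriv i w x
      = -∫ x, partialDeriv i (partialDeriv i v) x * w x := fun i =>
    integral_mul_fderiv_eq_neg_fderiv_mul_of_integrable (hi1 i) (hi2 i) (hi3 i)
      (fun x hx => ((hpv i).differentiableOn (by norm_num)).differentiableAt
        (hU.mem_nhds (hKU (hts hx))))
      (fun x _ => (hw1.differentiable (by norm_num)) x)
  calc ∫ x, U.indicator (fun x => η (v x) * gradSq v x) x
      = ∫ x, (partialDeriv 0 v x * partialDeriv 0 w x
          + partialDeriv 1 v x * partialDeriv 1 w x) := by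
        congr 1
        ext x
        rw [hp, hp]
        by_cases hx : x ∈ U
        · simp only [Set.indicator_of_mem hx, gradSq]
          ring
        · simp [Set.indicator_of_notMem hx]
    _ = -∫ x, laplace v x * w x := by
        rw [integral_add (hi2 0) (hi2 1), hibp, hibp, ← neg_add,
          ← integral_add (hi1 0) (hi1 1)]
        simp only [laplace, add_mul]

/-- The Cauchy–Schwarz inequality `(∫ a b)² ≤ ∫ a · ∫ a b²` with a nonnegative weight `a`. -/
theorem sq_integral_mul_le {α : Type*} [MeasurableSpace α] {μ : Measure α} {a b : α → ℝ}
    (ha0 : ∀ x, 0 ≤ a x) (ha : Integrable a μ) (hab : Integrable (fun x => a x * b x) μ)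
    (habb : Integrable (fun x => a x * b x ^ 2) μ) :
    (∫ x, a x * b x ∂μ) ^ 2 ≤ (∫ x, a x ∂μ) * ∫ x, a x * b x ^ 2 ∂μ := by
  have h : ∀ r : ℝ, 0 ≤ (∫ x, a x ∂μ) * (r * r) + (-2 * ∫ x, a x * b x ∂μ) * r
      + ∫ x, a x * b x ^ 2 ∂μ := by
    intro r
    have h0 : 0 ≤ ∫ x, a x * (r - b x) ^ 2 ∂μ :=
      integral_nonneg fun x => mul_nonneg (ha0 x) (sq_nonneg _)
    have h1 : ∫ x, a x * (r - b x) ^ 2 ∂μ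
        = ∫ x, (a x * (r * r) + a x * b x * (-2 * r) + a x * b x ^ 2) ∂μ := by
      congr 1
      ext x
      ring
    have h2 : Integrable (fun x => a x * (r * r) + a x * b x * (-2 * r)) μ :=
      (ha.mul_const _).add (hab.mul_const _)
    rw [h1, integral_add h2 habb, integral_add (ha.mul_const _) (hab.mul_const _),
      integral_mul_const, integral_mul_const] at h0
    linarith
  have := discrim_le_zero h
  rw [discrim] at this
  linarith

/-! ### A finite-difference form of Talenti's inequality -/

set_option maxHeartbeats 400000 in
/-- The sharp Sobolev inequality for a truncation of `v` between the levels `t` and `t + h`,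
combined with the Cauchy–Schwarz inequality and Green's formula; `ε` is the loss caused by
smoothing the truncation. -/
theorem four_pi_mul_volume_superlevel_le_of_lt {U : Set Plane} (hU : IsOpen U) {v : Plane → ℝ}
    (hv : ContDiffOn ℝ 2 v U) {t h ε : ℝ} (hh : 0 < h) (hε : 0 < ε) (hεh : ε < h)
    (hK : IsCompact {x ∈ U | t ≤ v x}) :
    4 * Real.pi * ((h - ε) ^ 2 * volume.real {x ∈ U | t + h < v x})
      ≤ (volume.real {x ∈ U | t < v x} - volume.real {x ∈ U | t + h < v x})
        * (h * ∫ x in {x ∈ U | t < v x}, max (-laplace v x) 0) := by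
  set S := {x ∈ U | t < v x} with hS
  set S' := {x ∈ U | t + h < v x} with hS'
  set J := ∫ x in S, max (-laplace v x) 0 with hJ
  have hJ0 : 0 ≤ J := integral_nonneg fun x => le_max_right _ _
  have hSo : IsOpen S := hv.continuousOn.isOpen_inter_preimage hU isOpen_Ioi
  have hSo' : IsOpen S' := hv.continuousOn.isOpen_inter_preimage hU isOpen_Ioi
  have hSK : S ⊆ {x ∈ U | t ≤ v x} := fun x hx => ⟨hx.1, hx.2.le⟩
  have hSS : S' ⊆ S := fun x hx => ⟨hx.1, by linarith [hx.2]⟩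
  have hSfin : volume S ≠ ⊤ := ((measure_mono hSK).trans_lt hK.measure_lt_top).ne
  have hSfin' : volume S' ≠ ⊤ := ((measure_mono hSS).trans_lt hSfin.lt_top).ne
  have hKU : {x ∈ U | t ≤ v x} ⊆ U := fun x hx => hx.1
  have hpv : ∀ i, ContDiffOn ℝ 1 (partialDeriv i v) U := fun i =>
    contDiffOn_partialDeriv hU hv (by norm_num) i
  have hlap : ContinuousOn (laplace v) U := continuousOn_laplace hU hv
  have hgrad : ContinuousOn (gradSq v) U :=
    ((hpv 0).continuousOn.pow 2).add ((hpv 1).continuousOn.pow 2)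
  have hlapi : IntegrableOn (fun x => max (-laplace v x) 0) S :=
    (((hlap.neg.sup continuousOn_const).mono hKU).integrableOn_compact hK).mono_set hSK
  obtain ⟨φ, η, hηc, hφ, hη, hlow, hhigh, hφb⟩ := exists_truncation t hε hεh
  set w := U.indicator fun x => φ (v x) with hw
  have hw1 : ContDiff ℝ 1 w :=
    contDiff_truncation hU (hv.of_le (by norm_num)) hK hηc hφ fun s hs => (hlow s hs).1
  have hp : ∀ i x, partialDeriv i w x
      = U.indicator (fun x => η (v x) * partialDeriv i v x) x :=
    partialDeriv_truncation hU (hv.differentiableOn (by norm_num)) hK hφ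
      fun s hs => (hlow s hs).1
  have hw0 : ∀ x ∉ S, w x = 0 := by
    intro x hx
    by_cases hxU : x ∈ U
    · rw [hw, Set.indicator_of_mem hxU]
      exact (hlow _ (not_lt.1 fun h => hx ⟨hxU, h⟩)).1
    · exact Set.indicator_of_notMem hxU _
  have hwc : HasCompactSupport w :=
    HasCompactSupport.intro hK fun x hx => hw0 x fun h => hx (hSK h)
  have hwb : ∀ x, 0 ≤ w x ∧ w x ≤ h := by
    intro x
    by_cases hxU : x ∈ U
    · rw [hw, Set.indicator_of_mem hxU]
      exact hφb _
    · rw [hw, Set.indicator_of_notMem hxU]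
      exact ⟨le_rfl, hh.le⟩
  -- the weight `φ'(v)`, extended by zero
  set a := U.indicator fun x => η (v x) with ha
  have ha0 : ∀ x, 0 ≤ a x := fun x => Set.indicator_nonneg (fun y _ => (hη _).1) x
  have haK : ∀ x ∉ {x ∈ U | t ≤ v x}, a x = 0 := by
    intro x hx
    by_cases hxU : x ∈ U
    · rw [ha, Set.indicator_of_mem hxU]
      exact (hlow _ (not_le.1 fun h => hx ⟨hxU, h⟩).le).2
    · exact Set.indicator_of_notMem hxU _
  have hac : ContinuousOn a U :=
    (hηc.comp_continuousOn hv.continuousOn).congr fun x hx => by simp [ha, hx]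
  have hint : ∀ b : Plane → ℝ, ContinuousOn b U → Integrable fun x => a x * b x := fun b hb =>
    integrable_of_continuousOn_of_eq_zero (hac.mul hb) hK hKU fun x hx => by simp [haK x hx]
  have hai : Integrable a := by simpa using hint (fun _ => 1) continuousOn_const
  have hsob := sobolev_plane hw1 hwc fun x => (hwb x).1
  have hgw : ∀ x, Real.sqrt (gradSq w x) = a x * Real.sqrt (gradSq v x) := by
    intro x
    simp only [gradSq, hp]
    by_cases hxU : x ∈ U
    · simp only [ha, Set.indicator_of_mem hxU]
      rw [mul_pow, mul_pow, ← mul_add, Real.sqrt_mul (sq_nonneg _), Real.sqrt_sq (hη _).1]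
    · simp [ha, Set.indicator_of_notMem hxU]
  have hgreen : ∫ x, a x * Real.sqrt (gradSq v x) ^ 2 ≤ h * J := by
    have h1 : ∫ x, a x * Real.sqrt (gradSq v x) ^ 2
        = ∫ x, U.indicator (fun x => η (v x) * gradSq v x) x := by
      congr 1
      ext x
      rw [Real.sq_sqrt (gradSq_nonneg v x)]
      by_cases hxU : x ∈ U <;> simp [ha, hxU]
    rw [h1, integral_truncation_gradSq hU hv hK hηc hφ hlow, ← integral_neg, hJ,
      ← integral_const_mul, ← setIntegral_eq_integral_of_forall_compl_eq_zero (s := S)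
        fun x hx => by rw [← hw, hw0 x hx, mul_zero, neg_zero]]
    refine setIntegral_mono_on ?_ (hlapi.const_mul h) hSo.measurableSet fun x _ => ?_
    · have := integrable_of_continuousOn_of_eq_zero
        (hlap.mul hw1.continuous.continuousOn) hK hKU
        fun x hx => by rw [Pi.mul_apply, hw0 x fun h => hx (hSK h), mul_zero]
      exact this.neg.integrableOn
    · rw [← hw, ← neg_mul, mul_comm]
      calc w x * -laplace v x ≤ w x * max (-laplace v x) 0 :=
            mul_le_mul_of_nonneg_left (le_max_left _ _) (hwb x).1
        _ ≤ h * max (-laplace v x) 0 :=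
            mul_le_mul_of_nonneg_right (hwb x).2 (le_max_right _ _)
  have hvol : ∫ x, a x ≤ volume.real S - volume.real S' := by
    rw [← measureReal_sdiff hSS hSo'.measurableSet hSfin, ← integral_indicator_one
      (hSo.measurableSet.diff hSo'.measurableSet)]
    refine integral_mono hai ?_ fun x => ?_
    · exact (integrable_indicator_iff (hSo.measurableSet.diff hSo'.measurableSet)).2
        (integrableOn_const ((measure_mono Set.sdiff_subset).trans_lt hSfin.lt_top).ne)
    · by_cases hx : x ∈ S \ S'
      · rw [Set.indicator_of_mem hx, ha, Set.indicator_of_mem hx.1.1]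
        exact (hη _).2
      · rw [Set.indicator_of_notMem hx]
        by_cases hxU : x ∈ U
        · rw [ha, Set.indicator_of_mem hxU]
          by_cases h1 : t < v x
          · have h2 : t + h ≤ v x := not_lt.1 fun h3 => hx ⟨⟨hxU, h1⟩, fun h4 => by
              linarith [h4.2]⟩
            exact (hhigh _ h2).1.le
          · exact (hlow _ (not_lt.1 h1)).2.le
        · exact (Set.indicator_of_notMem hxU _).le
  have hlowb : (h - ε) ^ 2 * volume.real S' ≤ ∫ x, w x ^ 2 := by
    have hw2i : Integrable fun x => w x ^ 2 :=
      integrable_of_continuousOn_of_eq_zero (hw1.continuous.pow 2).continuousOn hK hKU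
        fun x hx => by rw [hw0 x fun h => hx (hSK h), zero_pow two_ne_zero]
    calc (h - ε) ^ 2 * volume.real S' = ∫ x in S', (h - ε) ^ 2 := by
          rw [setIntegral_const, smul_eq_mul, mul_comm]
      _ ≤ ∫ x in S', w x ^ 2 := by
          refine setIntegral_mono_on (integrableOn_const hSfin') hw2i.integrableOn
            hSo'.measurableSet fun x hx => ?_
          rw [hw, Set.indicator_of_mem hx.1]
          exact pow_le_pow_left₀ (by linarith) (hhigh _ hx.2.le).2 2
      _ ≤ ∫ x, w x ^ 2 := setIntegral_le_integral hw2i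
          (Filter.Eventually.of_forall fun x => sq_nonneg _)
  have hcs := sq_integral_mul_le ha0 hai (hint (fun x => Real.sqrt (gradSq v x)) hgrad.sqrt)
    (hint (fun x => Real.sqrt (gradSq v x) ^ 2) (hgrad.sqrt.pow 2))
  simp only [hgw] at hsob
  calc 4 * Real.pi * ((h - ε) ^ 2 * volume.real S') ≤ 4 * Real.pi * ∫ x, w x ^ 2 :=
        mul_le_mul_of_nonneg_left hlowb (by positivity)
    _ ≤ _ := hsob
    _ ≤ _ := hcs
    _ ≤ (∫ x, a x) * (h * J) := mul_le_mul_of_nonneg_left hgreen (integral_nonneg ha0)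
    _ ≤ _ := mul_le_mul_of_nonneg_right hvol (by positivity)
/-- A finite-difference form of Talenti's inequality between two levels `t < t + h`. -/
theorem four_pi_mul_volume_superlevel_le {U : Set Plane} (hU : IsOpen U) {v : Plane → ℝ}
    (hv : ContDiffOn ℝ 2 v U) {t h : ℝ} (hh : 0 < h) (hK : IsCompact {x ∈ U | t ≤ v x}) :
    4 * Real.pi * h * volume.real {x ∈ U | t + h < v x}
      ≤ (volume.real {x ∈ U | t < v x} - volume.real {x ∈ U | t + h < v x})
        * ∫ x in {x ∈ U | t < v x}, max (-laplace v x) 0 := by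
  set S := {x ∈ U | t < v x} with hS
  set S' := {x ∈ U | t + h < v x} with hS'
  set J := ∫ x in S, max (-laplace v x) 0 with hJ
  have hlim : 4 * Real.pi * ((h - 0) ^ 2 * volume.real S')
      ≤ (volume.real S - volume.real S') * (h * J) := by
    refine le_of_tendsto (x := nhdsWithin 0 (Set.Ioi 0))
      (f := fun ε => 4 * Real.pi * ((h - ε) ^ 2 * volume.real S')) ?_ ?_
    · exact ((by fun_prop : Continuous fun ε : ℝ =>
        4 * Real.pi * ((h - ε) ^ 2 * volume.real S')).tendsto 0).mono_left nhdsWithin_le_nhds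
    · filter_upwards [Ioo_mem_nhdsGT hh] with ε hε using
        four_pi_mul_volume_superlevel_le_of_lt hU hv hh hε.1 hε.2 hK
  refine le_of_mul_le_mul_left ?_ hh
  calc _ = 4 * Real.pi * ((h - 0) ^ 2 * volume.real S') := by ring
    _ ≤ _ := hlim
    _ = _ := by ring

/-! ### Integration of the differential inequality -/

/-- The tangent line to `s ↦ s^q` at `x` lies below the graph. -/
theorem rpow_sub_rpow_le {x y q : ℝ} (hx : 0 < x) (hy : 0 ≤ y) (hq : 1 ≤ q) :
    x ^ q - y ^ q ≤ q * x ^ (q - 1) * (x - y) := by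
  have h := one_add_mul_self_le_rpow_one_add (s := y / x - 1) (by
    have : 0 ≤ y / x := by positivity
    linarith) hq
  rw [add_sub_cancel, Real.div_rpow hy hx.le, le_div_iff₀ (by positivity)] at h
  have h2 : x ^ q = x ^ (q - 1) * x := by
    rw [← Real.rpow_add_one hx.ne', sub_add_cancel]
  have h3 : (1 + q * (y / x - 1)) * x ^ q = x ^ q + q * x ^ (q - 1) * (y - x) := by
    rw [h2]
    field_simp
  linarith

/-- If `a` is nonincreasing and `c h a(t + h) ≤ κ (a(t) - a(t + h)) a(t)^(1/q)`, then
`c T ≤ q κ a(0)^(1/q)` as long as `a(T) > 0`. With `b = a^(1/q)`, summation over the `n` steps of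
a uniform partition of `[0, T]` bounds the mean of the `q`-th powers of the ratios of consecutive
values of `b`; by the inequality of means this is at least `(a(T) / a(0))^(1/n)`, which tends to
`1`. -/
theorem mul_le_of_discrete_differential_inequality {a : ℝ → ℝ} (ha : Antitone a) {c κ q T : ℝ}
    (hq : 1 ≤ q) (hκ : 0 ≤ κ) (hc : 0 ≤ c) (hT : 0 < T) (haT : 0 < a T)
    (h : ∀ t s, 0 ≤ t → 0 < s → c * s * a (t + s) ≤ κ * (a t - a (t + s)) * a t ^ (1 / q)) :
    c * T ≤ q * κ * a 0 ^ (1 / q) := by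
  have ha0 : 0 < a 0 := haT.trans_le (ha hT.le)
  have hq0 : 0 < q := by linarith
  have main : ∀ n : ℕ, 1 ≤ n →
      c * T * (a T / a 0) ^ (1 / (n : ℝ)) ≤ q * κ * a 0 ^ (1 / q) := by
    intro n hn
    have hn0 : (0 : ℝ) < n := by exact_mod_cast hn
    set s := T / n with hs
    have hs0 : 0 < s := by positivity
    set α : ℕ → ℝ := fun i => a (i * s) with hα
    have hαT : α n = a T := by
      simp only [hα, hs]
      rw [mul_div_cancel₀ _ hn0.ne']
    have hα0 : α 0 = a 0 := by simp [hα]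
    have hpos : ∀ i ≤ n, 0 < α i := fun i hi => by
      rw [← hαT] at haT
      refine haT.trans_le (ha ?_)
      have : (i : ℝ) ≤ n := by exact_mod_cast hi
      gcongr
    have hstep : ∀ i ∈ Finset.range n, c * s * (α (i + 1) / α i)
        ≤ q * κ * (α i ^ (1 / q) - α (i + 1) ^ (1 / q)) := by
      intro i hi
      have hi' := Finset.mem_range.1 hi
      have hx := hpos i hi'.le
      have hy := hpos (i + 1) hi'
      have hxq : (α i ^ (1 / q)) ^ q = α i := by
        rw [← Real.rpow_mul hx.le, one_div_mul_cancel hq0.ne', Real.rpow_one]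
      have hyq : (α (i + 1) ^ (1 / q)) ^ q = α (i + 1) := by
        rw [← Real.rpow_mul hy.le, one_div_mul_cancel hq0.ne', Real.rpow_one]
      have h1 := h (i * s) s (by positivity) hs0
      rw [show (i : ℝ) * s + s = ((i + 1 : ℕ) : ℝ) * s by push_cast; ring] at h1
      have hb : 0 < α i ^ (1 / q) := Real.rpow_pos_of_pos hx _
      have h2 := rpow_sub_rpow_le hb (Real.rpow_nonneg hy.le (1 / q)) hq
      rw [hxq, hyq] at h2
      have h3 : (α i ^ (1 / q)) ^ (q - 1) * α i ^ (1 / q) = α i := by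
        rw [← Real.rpow_add_one hb.ne', sub_add_cancel, hxq]
      rw [← mul_div_assoc, div_le_iff₀ hx]
      calc c * s * α (i + 1) ≤ κ * (α i - α (i + 1)) * α i ^ (1 / q) := h1
        _ ≤ κ * (q * (α i ^ (1 / q)) ^ (q - 1) * (α i ^ (1 / q) - α (i + 1) ^ (1 / q)))
            * α i ^ (1 / q) := by gcongr
        _ = q * κ * (α i ^ (1 / q) - α (i + 1) ^ (1 / q))
            * ((α i ^ (1 / q)) ^ (q - 1) * α i ^ (1 / q)) := by ring
        _ = _ := by rw [h3]
    have hsum := Finset.sum_le_sum hstep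
    rw [← Finset.mul_sum, ← Finset.mul_sum, Finset.sum_range_sub'] at hsum
    have hgm := Real.geom_mean_le_arith_mean (Finset.range n) (fun _ => 1)
      (fun i => α (i + 1) / α i) (fun _ _ => zero_le_one) (by simpa using Nat.lt_of_succ_le hn)
      (fun i hi => div_nonneg (hpos _ (Finset.mem_range.1 hi)).le
        (hpos _ (Finset.mem_range.1 hi).le).le)
    have htel : ∏ i ∈ Finset.range n, α (i + 1) / α i = a T / a 0 := by
      rw [← hαT, ← hα0]
      have : ∀ m ≤ n, ∏ i ∈ Finset.range m, α (i + 1) / α i = α m / α 0 := by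
        intro m
        induction m with
        | zero => intro _; simp [(hpos 0 (Nat.zero_le _)).ne']
        | succ m ih =>
          intro hm
          have := (hpos m (by omega)).ne'
          rw [Finset.prod_range_succ, ih (by omega)]
          field_simp
      exact this n le_rfl
    simp only [Real.rpow_one, one_mul, Finset.sum_const, Finset.card_range, nsmul_eq_mul,
      mul_one, htel] at hgm
    rw [le_div_iff₀ hn0] at hgm
    have hbT : 0 ≤ α n ^ (1 / q) := Real.rpow_nonneg (hpos n le_rfl).le _
    calc c * T * (a T / a 0) ^ (1 / (n : ℝ))
        = c * s * ((a T / a 0) ^ ((n : ℝ)⁻¹) * n) := by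
          rw [one_div, hs]
          field_simp
      _ ≤ c * s * ∑ i ∈ Finset.range n, α (i + 1) / α i :=
          mul_le_mul_of_nonneg_left hgm (by positivity)
      _ ≤ _ := hsum
      _ ≤ _ := by
          rw [← hα0]
          gcongr
          linarith
  have hlim : Filter.Tendsto (fun n : ℕ => c * T * (a T / a 0) ^ (1 / (n : ℝ))) Filter.atTop
      (nhds (c * T * (a T / a 0) ^ (0 : ℝ))) :=
    (tendsto_const_nhds.rpow tendsto_one_div_atTop_nhds_zero_nat
      (Or.inl (div_pos haT ha0).ne')).const_mul _
  rw [Real.rpow_zero, mul_one] at hlim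
  exact le_of_tendsto hlim (Filter.eventually_atTop.2 ⟨1, main⟩)

/-! ### The area measure and the curvature of `e^{2u} g₀` -/

theorem areaMeasure_conformalChange (G : Set Plane) (u : Plane → ℝ) :
    areaMeasure G (conformalChange u flatMetric)
      = (volume.restrict G).withDensity fun x => ENNReal.ofReal (Real.exp (2 * u x)) := by
  simp only [areaMeasure, det_conformalChange_flatMetric, Real.sqrt_sq (Real.exp_pos _).le]

theorem areaMeasure_univ_eq {G : Set Plane} (hGo : IsOpen G) (g : MetricField) :
    areaMeasure G g Set.univ = areaMeasure G g G := by
  rw [areaMeasure, withDensity_apply _ MeasurableSet.univ, withDensity_apply _ hGo.measurableSet,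
    Measure.restrict_univ, Measure.restrict_restrict hGo.measurableSet, Set.inter_self]

theorem areaMeasure_conformalChange_restrict {G S : Set Plane} (hS : MeasurableSet S)
    (hSG : S ⊆ G) (u : Plane → ℝ) :
    (areaMeasure G (conformalChange u flatMetric)).restrict S
      = (volume.restrict S).withDensity fun x => ENNReal.ofReal (Real.exp (2 * u x)) := by
  rw [areaMeasure_conformalChange, restrict_withDensity hS, Measure.restrict_restrict hS,
    Set.inter_eq_left.2 hSG]

theorem integrableOn_exp_two_mul {G : Set Plane} (hGo : IsOpen G) (hGfin : volume G ≠ ⊤)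
    {u : Plane → ℝ} (hu : ContinuousOn u G) (hu0 : ∀ x ∈ G, u x ≤ 0) :
    IntegrableOn (fun x => Real.exp (2 * u x)) G := by
  have hm := (by fun_prop : ContinuousOn (fun x => Real.exp (2 * u x)) G).aestronglyMeasurable
    (μ := volume) hGo.measurableSet
  refine IntegrableOn.of_bound hGfin.lt_top hm 1 ?_
  filter_upwards [ae_restrict_mem hGo.measurableSet] with x hx
  rw [Real.norm_of_nonneg (Real.exp_pos _).le]
  exact Real.exp_le_one_iff.2 (by linarith [hu0 x hx])

theorem areaMeasure_real_eq {G S : Set Plane} (hGo : IsOpen G) (hGfin : volume G ≠ ⊤)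
    {u : Plane → ℝ} (hu : ContinuousOn u G) (hu0 : ∀ x ∈ G, u x ≤ 0) (hS : MeasurableSet S)
    (hSG : S ⊆ G) :
    areaMeasure G (conformalChange u flatMetric) S ≠ ⊤ ∧
      (areaMeasure G (conformalChange u flatMetric)).real S
        = ∫ x in S, Real.exp (2 * u x) := by
  have hi := (integrableOn_exp_two_mul hGo hGfin hu hu0).mono_set hSG
  have h : areaMeasure G (conformalChange u flatMetric) S
      = ENNReal.ofReal (∫ x in S, Real.exp (2 * u x)) := by
    rw [← Measure.restrict_apply_self, areaMeasure_conformalChange_restrict hS hSG,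
      withDensity_apply _ hS, Measure.restrict_restrict hS, Set.inter_self,
      ofReal_integral_eq_lintegral_ofReal hi
        (Filter.Eventually.of_forall fun x => (Real.exp_pos _).le)]
  refine ⟨by simp [h], ?_⟩
  rw [measureReal_def, h, ENNReal.toReal_ofReal (integral_nonneg fun x => (Real.exp_pos _).le)]

theorem min_gaussCurvature_zero {G : Set Plane} (hGo : IsOpen G) {u : Plane → ℝ}
    (hu : ContDiffOn ℝ 2 u G) {x : Plane} (hx : x ∈ G) :
    min (gaussCurvature (conformalChange u flatMetric) x) 0
      = -((Real.exp (2 * u x))⁻¹ * max (laplace u x) 0) := by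
  rw [gaussCurvature_conformalChange hGo hu hx, mul_max_of_nonneg _ _ (by positivity), mul_zero,
    ← min_neg_neg, neg_zero, neg_mul]

theorem continuousOn_min_gaussCurvature {G : Set Plane} (hGo : IsOpen G) {u : Plane → ℝ}
    (hu : ContDiffOn ℝ 2 u G) :
    ContinuousOn (fun x => min (gaussCurvature (conformalChange u flatMetric) x) 0) G := by
  have h1 := continuousOn_laplace hGo hu
  have h2 := hu.continuousOn
  refine ContinuousOn.congr (f := fun x => -((Real.exp (2 * u x))⁻¹ * max (laplace u x) 0)) ?_
    fun x hx => min_gaussCurvature_zero hGo hu hx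
  exact (((by fun_prop : ContinuousOn (fun x => Real.exp (2 * u x)) G).inv₀
    fun x _ => (Real.exp_pos _).ne').mul (h1.sup continuousOn_const)).neg

/-- Hölder's inequality: the total positive part of `Δu` on `S`, which is the total negative
curvature of `e^{2u} g₀` on `S`, is controlled by the `Lᵖ` norm and the area. -/
theorem integral_laplace_pos_le {G S : Set Plane} (hGo : IsOpen G) (hGfin : volume G ≠ ⊤)
    {u : Plane → ℝ} (hu : ContDiffOn ℝ 2 u G) (hu0 : ∀ x ∈ G, u x ≤ 0) (hS : MeasurableSet S)
    (hSG : S ⊆ G) {p : ℝ} (hp : 1 < p)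
    (hK : eLpNorm (fun x => min (gaussCurvature (conformalChange u flatMetric) x) 0)
      (ENNReal.ofReal p) (areaMeasure G (conformalChange u flatMetric)) ≠ ⊤) :
    ∫ x in S, max (laplace u x) 0
      ≤ (eLpNorm (fun x => min (gaussCurvature (conformalChange u flatMetric) x) 0)
          (ENNReal.ofReal p) (areaMeasure G (conformalChange u flatMetric))).toReal
        * (areaMeasure G (conformalChange u flatMetric)).real S ^ (1 - 1 / p) := by
  set A := areaMeasure G (conformalChange u flatMetric) with hA
  set k := fun x => min (gaussCurvature (conformalChange u flatMetric) x) 0 with hk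
  have hu' := hu.continuousOn
  have hkm : AEStronglyMeasurable k (volume.restrict S) :=
    ((continuousOn_min_gaussCurvature hGo hu).mono hSG).aestronglyMeasurable hS
  have hρm : AEMeasurable (fun x => ENNReal.ofReal (Real.exp (2 * u x))) (volume.restrict S) :=
    (((by fun_prop : ContinuousOn (fun x => Real.exp (2 * u x)) G).mono hSG).aemeasurable
      hS).ennreal_ofReal
  have hAS := areaMeasure_conformalChange_restrict hS hSG u
  have hl : ∫⁻ x in S, ENNReal.ofReal (max (laplace u x) 0) = eLpNorm k 1 (A.restrict S) := by
    rw [eLpNorm_one_eq_lintegral_enorm, hA, hAS,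
      lintegral_withDensity_eq_lintegral_mul₀ hρm hkm.enorm]
    refine setLIntegral_congr_fun hS fun x hx => ?_
    have he := Real.exp_pos (2 * u x)
    simp only [hk, Pi.mul_apply]
    rw [min_gaussCurvature_zero hGo hu (hSG hx), enorm_neg, Real.enorm_eq_ofReal (by positivity),
      ← ENNReal.ofReal_mul he.le, mul_inv_cancel_left₀ he.ne']
  have hAfin : A S ≠ ⊤ := (areaMeasure_real_eq hGo hGfin hu' hu0 hS hSG).1
  have hh : eLpNorm k 1 (A.restrict S)
      ≤ eLpNorm k (ENNReal.ofReal p) A * A S ^ (1 - 1 / p) := by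
    have hm : AEStronglyMeasurable k (A.restrict S) := by
      rw [hA, hAS]
      exact hkm.mono_ac (withDensity_absolutelyContinuous _ _)
    have := eLpNorm_le_eLpNorm_mul_rpow_measure_univ (μ := A.restrict S) (p := 1)
      (q := ENNReal.ofReal p) (by simpa using hp.le) hm
    rw [ENNReal.toReal_one, ENNReal.toReal_ofReal (by linarith), Measure.restrict_apply_univ,
      div_one] at this
    refine this.trans ?_
    gcongr
    exact Measure.restrict_le_self
  have hexp : 0 ≤ 1 - 1 / p := by
    rw [sub_nonneg, div_le_one (by linarith)]
    exact hp.le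
  have hlm : AEStronglyMeasurable (fun x => max (laplace u x) 0) (volume.restrict S) :=
    (((continuousOn_laplace hGo hu).sup continuousOn_const).mono hSG).aestronglyMeasurable hS
  rw [integral_eq_lintegral_of_nonneg_ae
    (Filter.Eventually.of_forall fun x => le_max_right (laplace u x) 0) hlm, hl]
  refine (ENNReal.toReal_mono (ENNReal.mul_ne_top hK (ENNReal.rpow_ne_top_of_nonneg hexp hAfin))
    hh).trans_eq ?_
  rw [ENNReal.toReal_mul, ← ENNReal.toReal_rpow, measureReal_def]

/-- Second derivatives of a function that is smooth up to the boundary are bounded: near each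
point of the closure they agree, at the interior points, with a continuous term of a Taylor
series of `u` on the closure. -/
theorem exists_laplace_bound {G : Set Plane} (hGo : IsOpen G) (hGb : Bornology.IsBounded G)
    {u : Plane → ℝ} (hu : ContDiffOn ℝ 2 u (closure G)) :
    ∃ C, ∀ x ∈ G, |laplace u x| ≤ C := by
  have hcomp : IsCompact (closure G) := hGb.isCompact_closure
  have hint : ∀ y ∈ G, ∀ i j, |partialDeriv i (partialDeriv j u) y|
      ≤ ‖iteratedFDeriv ℝ 2 u y‖ := by
    intro y hy i j
    have hfd : DifferentiableAt ℝ (fderiv ℝ u) y :=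
      (((hu.mono subset_closure).fderiv_of_isOpen hGo (m := 1)
        (by norm_num)).differentiableOn (by norm_num)).differentiableAt (hGo.mem_nhds hy)
    have h1 : partialDeriv i (partialDeriv j u) y
        = fderiv ℝ (fderiv ℝ u) y (EuclideanSpace.single i 1) (EuclideanSpace.single j 1) := by
      unfold partialDeriv
      rw [fderiv_clm_apply hfd (differentiableAt_const _)]
      simp
    have h2 := (iteratedFDeriv ℝ 2 u y).le_opNorm
      ![EuclideanSpace.single i 1, EuclideanSpace.single j 1]
    rw [iteratedFDeriv_two_apply] at h2
    simp only [Matrix.cons_val_zero, Matrix.cons_val_one, Fin.prod_univ_two,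
      PiLp.norm_single, norm_one, mul_one] at h2
    rw [h1]
    exact h2
  have hloc : ∃ C, ∀ y ∈ closure G ∩ G, ‖iteratedFDeriv ℝ 2 u y‖ ≤ C := by
    refine hcomp.induction_on (p := fun s => ∃ C, ∀ y ∈ s ∩ G, ‖iteratedFDeriv ℝ 2 u y‖ ≤ C)
      ⟨0, by simp⟩ (fun s t hst ⟨C, hC⟩ => ⟨C, fun y hy => hC y ⟨hst hy.1, hy.2⟩⟩)
      (fun s t ⟨C, hC⟩ ⟨C', hC'⟩ => ⟨max C C', fun y hy => ?_⟩) fun x hx => ?_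
    · rcases hy.1 with h | h
      · exact (hC y ⟨h, hy.2⟩).trans (le_max_left _ _)
      · exact (hC' y ⟨h, hy.2⟩).trans (le_max_right _ _)
    · obtain ⟨V, hV, P, hP⟩ := contDiffWithinAt_nat.1 (hu x hx)
      rw [Set.insert_eq_of_mem hx] at hV
      have hxV : x ∈ V := mem_of_mem_nhdsWithin hx hV
      have hcont : ContinuousWithinAt (fun y => ‖P y 2‖) V x := (hP.cont 2 le_rfl x hxV).norm
      have hev : ∀ᶠ y in nhdsWithin x (closure G), y ∈ V ∧ ‖P y 2‖ < ‖P x 2‖ + 1 :=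
        Filter.Eventually.and hV (nhdsWithin_le_iff.2 hV
          (hcont.eventually (gt_mem_nhds (lt_add_one _))))
      obtain ⟨O, hO, hxO, hsub⟩ := mem_nhdsWithin.1 hev
      refine ⟨O, mem_nhdsWithin_of_mem_nhds (hO.mem_nhds hxO), ‖P x 2‖ + 1, fun y hy => ?_⟩
      have hOG : IsOpen (O ∩ G) := hO.inter hGo
      have hP' := hP.mono fun z (hz : z ∈ O ∩ G) => (hsub ⟨hz.1, subset_closure hz.2⟩).1
      rw [← iteratedFDerivWithin_of_isOpen 2 hOG hy,
        ← hP'.eq_iteratedFDerivWithin_of_uniqueDiffOn le_rfl hOG.uniqueDiffOn hy]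
      exact (hsub ⟨hy.1, subset_closure hy.2⟩).2.le
  obtain ⟨C, hC⟩ := hloc
  refine ⟨C + C, fun x hx => ?_⟩
  have hx' := hC x ⟨subset_closure hx, hx⟩
  exact (abs_add_le _ _).trans (add_le_add ((hint x hx 0 0).trans hx') ((hint x hx 1 1).trans hx'))

theorem eLpNorm_min_gaussCurvature_ne_top {G : Set Plane} (hGo : IsOpen G)
    (hGb : Bornology.IsBounded G) {u : Plane → ℝ} (hu : ContDiffOn ℝ 2 u (closure G))
    (hu0 : ∀ x ∈ closure G, u x ≤ 0) (p : ℝ) :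
    eLpNorm (fun x => min (gaussCurvature (conformalChange u flatMetric) x) 0)
      (ENNReal.ofReal p) (areaMeasure G (conformalChange u flatMetric)) ≠ ⊤ := by
  have huG := hu.mono (subset_closure (s := G))
  have hfin := hGb.measure_lt_top (μ := volume)
  obtain ⟨C, hC⟩ := exists_laplace_bound hGo hGb hu
  obtain ⟨m, hm⟩ := (hGb.isCompact_closure.image_of_continuousOn hu.continuousOn).bddBelow
  have hae : ∀ᵐ x ∂areaMeasure G (conformalChange u flatMetric), x ∈ G := by
    rw [areaMeasure_conformalChange]
    exact (withDensity_absolutelyContinuous _ _).ae_le (ae_restrict_mem hGo.measurableSet)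
  have hbd : ∀ᵐ x ∂areaMeasure G (conformalChange u flatMetric),
      ‖min (gaussCurvature (conformalChange u flatMetric) x) 0‖
        ≤ (Real.exp (2 * m))⁻¹ * C := by
    filter_upwards [hae] with x hx
    have hmx : m ≤ u x := hm ⟨x, subset_closure hx, rfl⟩
    have hl := hC x hx
    rw [min_gaussCurvature_zero hGo huG hx, norm_neg, Real.norm_of_nonneg (by positivity)]
    gcongr
    exact max_le ((le_abs_self _).trans hl) ((abs_nonneg _).trans hl)
  refine ((eLpNorm_le_of_ae_bound hbd).trans_lt (ENNReal.mul_lt_top ?_ ENNReal.ofReal_lt_top)).ne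
  refine ENNReal.rpow_lt_top_of_nonneg (by positivity) ?_
  rw [areaMeasure_univ_eq hGo]
  exact (areaMeasure_real_eq hGo hfin.ne huG.continuousOn
    (fun x hx => hu0 x (subset_closure hx)) hGo.measurableSet subset_rfl).1

/-- The finite-difference inequality for the `g`-areas `a(t)` of the sets `{u < -t}`. On
`{u < -(t + h)}` the density `e^{2u}` is at most `e^{-2(t + h)}`, and on its complement it is at
least that, so the inequality for Lebesgue measure carries over. -/
theorem four_pi_mul_area_sublevel_le {G : Set Plane} (hGo : IsOpen G) (hGfin : volume G ≠ ⊤)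
    {u : Plane → ℝ} (hu : ContDiffOn ℝ 2 u G) (hu0 : ∀ x ∈ G, u x ≤ 0) {t h p : ℝ}
    (hp : 1 < p) (hh : 0 < h) (hK : IsCompact {x ∈ G | t ≤ -u x})
    (hfin : eLpNorm (fun x => min (gaussCurvature (conformalChange u flatMetric) x) 0)
      (ENNReal.ofReal p) (areaMeasure G (conformalChange u flatMetric)) ≠ ⊤) :
    let A := areaMeasure G (conformalChange u flatMetric)
    4 * Real.pi * h * A.real {x ∈ G | t + h < -u x}
      ≤ (eLpNorm (fun x => min (gaussCurvature (conformalChange u flatMetric) x) 0)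
          (ENNReal.ofReal p) A).toReal
        * (A.real {x ∈ G | t < -u x} - A.real {x ∈ G | t + h < -u x})
        * A.real {x ∈ G | t < -u x} ^ (1 - 1 / p) := by
  intro A
  set S := {x ∈ G | t < -u x} with hS
  set S' := {x ∈ G | t + h < -u x} with hS'
  set E := Real.exp (-2 * (t + h)) with hE
  have hSo : IsOpen S := hu.continuousOn.neg.isOpen_inter_preimage hGo isOpen_Ioi
  have hSo' : IsOpen S' := hu.continuousOn.neg.isOpen_inter_preimage hGo isOpen_Ioi
  have hSG : S ⊆ G := fun x hx => hx.1
  have hSS : S' ⊆ S := fun x hx => ⟨hx.1, by linarith [hx.2]⟩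
  have hSfin : volume S ≠ ⊤ := ((measure_mono hSG).trans_lt hGfin.lt_top).ne
  have hSfin' : volume S' ≠ ⊤ := ((measure_mono hSS).trans_lt hSfin.lt_top).ne
  have hint := integrableOn_exp_two_mul hGo hGfin hu.continuousOn hu0
  have har := fun (B : Set Plane) hB hBG =>
    areaMeasure_real_eq (S := B) hGo hGfin hu.continuousOn hu0 hB hBG
  have hd : MeasurableSet (S \ S') := hSo.measurableSet.diff hSo'.measurableSet
  have h1 : A.real S' ≤ E * volume.real S' := by
    rw [(har S' hSo'.measurableSet (hSS.trans hSG)).2, mul_comm, ← smul_eq_mul,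
      ← setIntegral_const]
    refine setIntegral_mono_on (hint.mono_set (hSS.trans hSG)) (integrableOn_const hSfin')
      hSo'.measurableSet fun x hx => Real.exp_le_exp.2 (by linarith [hx.2])
  have h2 : E * (volume.real S - volume.real S') ≤ A.real S - A.real S' := by
    rw [← measureReal_sdiff hSS hSo'.measurableSet hSfin,
      ← measureReal_sdiff hSS hSo'.measurableSet (har S hSo.measurableSet hSG).1,
      (har _ hd (Set.sdiff_subset.trans hSG)).2, mul_comm, ← smul_eq_mul, ← setIntegral_const]
    refine setIntegral_mono_on (integrableOn_const
      ((measure_mono Set.sdiff_subset).trans_lt hSfin.lt_top).ne)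
      (hint.mono_set (Set.sdiff_subset.trans hSG)) hd fun x hx => Real.exp_le_exp.2 ?_
    have : ¬ t + h < -u x := fun h3 => hx.2 ⟨hx.1.1, h3⟩
    linarith
  have h3 := four_pi_mul_volume_superlevel_le hGo hu.neg hh hK
  have h4 := integral_laplace_pos_le hGo hGfin hu hu0 hSo.measurableSet hSG hp hfin
  set J := ∫ x in S, max (laplace u x) 0 with hJ
  have h5 : ∫ x in S, max (-laplace (-u) x) 0 = J := by
    simp only [hJ, show ∀ x, laplace (-u) x = -laplace u x from laplace_neg u, neg_neg]
  have hJ0 : 0 ≤ J := integral_nonneg fun x => le_max_right _ _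
  have h6 : 0 ≤ A.real S - A.real S' := sub_nonneg.2
    (measureReal_mono hSS (har S hSo.measurableSet hSG).1)
  calc 4 * Real.pi * h * A.real S' ≤ 4 * Real.pi * h * (E * volume.real S') := by gcongr
    _ = E * (4 * Real.pi * h * volume.real S') := by ring
    _ ≤ E * ((volume.real S - volume.real S') * J) := by
        rw [← h5]
        exact mul_le_mul_of_nonneg_left h3 (Real.exp_pos _).le
    _ = (E * (volume.real S - volume.real S')) * J := by ring
    _ ≤ (A.real S - A.real S') * J := mul_le_mul_of_nonneg_right h2 hJ0
    _ ≤ (A.real S - A.real S') * _ := mul_le_mul_of_nonneg_left h4 h6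
    _ = _ := by ring

/-! ### The lower bound for the conformal factor -/

theorem mainTheorem8 (G : Set Plane) (hGo : IsOpen G) (hGb : Bornology.IsBounded G)
    (hGne : G.Nonempty) (u : Plane → ℝ) (hu : ContDiffOn ℝ ∞ u (closure G))
    (hu_nonpos : ∀ x ∈ closure G, u x ≤ 0) (hu_bdry : ∀ x ∈ frontier G, u x = 0)
    (g : MetricField) (hg : g = conformalChange u flatMetric)
    (p q : ℝ) (hp : 1 < p) (hq : q = p / (p - 1)) :
    curvatureMinus p G g ≠ ⊤ ∧
      ∃ m : ℝ, IsLeast (u '' closure G) m ∧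
        m ≥ -(q * (curvatureMinus p G g).toReal / (4 * Real.pi)) := by
  subst hg
  have hu2 : ContDiffOn ℝ 2 u (closure G) := by exact_mod_cast contDiffOn_infty.1 hu 2
  have huG : ContDiffOn ℝ 2 u G := hu2.mono subset_closure
  have hu0 : ∀ x ∈ G, u x ≤ 0 := fun x hx => hu_nonpos x (subset_closure hx)
  have hGfin : volume G ≠ ⊤ := hGb.measure_lt_top.ne
  have hcomp : IsCompact (closure G) := hGb.isCompact_closure
  have hfin := eLpNorm_min_gaussCurvature_ne_top hGo hGb hu2 hu_nonpos p
  have har := fun (B : Set Plane) hB hBG =>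
    areaMeasure_real_eq (S := B) hGo hGfin huG.continuousOn hu0 hB hBG
  have hexp : 1 / q = 1 - 1 / p := by
    rw [hq]
    have : p - 1 ≠ 0 := by linarith
    field_simp
  have hq1 : 1 ≤ q := by
    rw [hq, le_div_iff₀ (by linarith)]
    linarith
  have hAfin := (har G hGo.measurableSet subset_rfl).1
  have hexp0 : 0 ≤ 1 - 1 / p := by
    rw [← hexp]
    positivity
  set A := areaMeasure G (conformalChange u flatMetric) with hA
  set κ := (eLpNorm (fun x => min (gaussCurvature (conformalChange u flatMetric) x) 0)
    (ENNReal.ofReal p) A).toReal with hκ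
  have hcurv : curvatureMinus p G (conformalChange u flatMetric)
      = eLpNorm (fun x => min (gaussCurvature (conformalChange u flatMetric) x) 0)
        (ENNReal.ofReal p) A * A G ^ (1 - 1 / p) := by
    rw [curvatureMinus, ← hA, hA, areaMeasure_univ_eq hGo]
  refine ⟨?_, ?_⟩
  · rw [hcurv]
    exact ENNReal.mul_ne_top hfin (ENNReal.rpow_ne_top_of_nonneg hexp0 hAfin)
  have htoReal : (curvatureMinus p G (conformalChange u flatMetric)).toReal
      = κ * A.real G ^ (1 / q) := by
    rw [hcurv, ENNReal.toReal_mul, ← ENNReal.toReal_rpow, hexp, measureReal_def]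
  obtain ⟨x₀, hx₀, hmin⟩ := hcomp.exists_isMinOn hGne.closure hu2.continuousOn
  refine ⟨u x₀, ⟨⟨x₀, hx₀, rfl⟩, ?_⟩, ?_⟩
  · rintro _ ⟨y, hy, rfl⟩
    exact hmin hy
  rw [htoReal, ge_iff_le, neg_le, le_div_iff₀ (by positivity)]
  have hκ0 : 0 ≤ κ := ENNReal.toReal_nonneg
  rcases (hu_nonpos x₀ hx₀).eq_or_lt with h0 | hneg
  · rw [h0, neg_zero, zero_mul]
    positivity
  have hx₀G : x₀ ∈ G := by
    by_contra hn
    exact hneg.ne (hu_bdry x₀ (by rw [hGo.frontier_eq]; exact ⟨hx₀, hn⟩))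
  set a : ℝ → ℝ := fun t => A.real {x ∈ G | t < -u x} with ha
  have hopen : ∀ t, IsOpen {x ∈ G | t < -u x} := fun t =>
    huG.continuousOn.neg.isOpen_inter_preimage hGo isOpen_Ioi
  have hanti : Antitone a := fun s t hst =>
    measureReal_mono (fun x hx => ⟨hx.1, hst.trans_lt hx.2⟩)
      (har _ (hopen s).measurableSet fun x hx => hx.1).1
  have hcpt : ∀ t, 0 < t → IsCompact {x ∈ G | t ≤ -u x} := by
    intro t ht
    have he : {x ∈ G | t ≤ -u x} = closure G ∩ (fun x => -u x) ⁻¹' Set.Ici t := by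
      ext x
      refine ⟨fun hx => ⟨subset_closure hx.1, hx.2⟩, fun hx => ⟨?_, hx.2⟩⟩
      by_contra hn
      have h1 := hu_bdry x (by rw [hGo.frontier_eq]; exact ⟨hx.1, hn⟩)
      have h2 : t ≤ -u x := hx.2
      linarith
    rw [he]
    exact hcomp.of_isClosed_subset
      (hu2.continuousOn.neg.preimage_isClosed_of_isClosed isClosed_closure isClosed_Ici)
      Set.inter_subset_left
  have hpos : ∀ t, t < -u x₀ → 0 < a t := by
    intro t ht
    simp only [ha]
    rw [(har _ (hopen t).measurableSet fun x hx => hx.1).2, setIntegral_pos_iff_support_of_nonneg_ae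
      (Filter.Eventually.of_forall fun x => (Real.exp_pos _).le)
      ((integrableOn_exp_two_mul hGo hGfin huG.continuousOn hu0).mono_set fun x hx => hx.1)]
    rw [Set.inter_eq_right.2 fun x _ => Function.mem_support.2 (Real.exp_pos _).ne']
    exact (hopen t).measure_pos _ ⟨x₀, hx₀G, ht⟩
  -- the superlevel set at `0` need not be relatively compact, so levels start at `δ > 0`
  have main : ∀ δ, 0 < δ → δ < -u x₀ / 2 →
      (-u x₀ - 2 * δ) * (4 * Real.pi) ≤ q * (κ * A.real G ^ (1 / q)) := by
    intro δ hδ hδ2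
    have h := mul_le_of_discrete_differential_inequality (a := fun t => a (t + δ))
      (c := 4 * Real.pi) (κ := κ) (q := q) (T := -u x₀ - 2 * δ)
      (fun s t hst => hanti (by linarith)) hq1 hκ0 (by positivity) (by linarith)
      (hpos _ (by linarith)) fun t s ht hs => by
        have := four_pi_mul_area_sublevel_le hGo hGfin huG hu0 hp hs
          (hcpt (t + δ) (by linarith)) hfin
        rw [add_right_comm t δ s, ← hexp] at this
        exact this
    have h2 : a (0 + δ) ≤ A.real G := measureReal_mono (fun x hx => hx.1) hAfin
    calc (-u x₀ - 2 * δ) * (4 * Real.pi) = 4 * Real.pi * (-u x₀ - 2 * δ) := mul_comm _ _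
      _ ≤ q * κ * a (0 + δ) ^ (1 / q) := h
      _ ≤ q * κ * A.real G ^ (1 / q) := by gcongr
      _ = _ := by ring
  have hlim : (-u x₀ - 2 * 0) * (4 * Real.pi) ≤ q * (κ * A.real G ^ (1 / q)) := by
    refine le_of_tendsto (x := nhdsWithin 0 (Set.Ioi 0))
      (f := fun δ => (-u x₀ - 2 * δ) * (4 * Real.pi)) ?_ ?_
    · exact ((by fun_prop : Continuous fun δ : ℝ =>
        (-u x₀ - 2 * δ) * (4 * Real.pi)).tendsto 0).mono_left nhdsWithin_le_nhds
    · filter_upwards [Ioo_mem_nhdsGT (show 0 < -u x₀ / 2 by linarith)] with δ hδ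
        using main δ hδ.1 hδ.2
  simpa using hlim
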